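/- Let $d\ge 3$ and $j\ge 1$ be integers and let $c>0$. For $n\ge1$ and $t>0$ let $GD(a;b)$, with $a,b\in(0,\infty)^n$, be the rescaled generalized Dirichlet law, with density $$C(a,b,t)\prod_{k=1}^n\tau_k^{a_k-1}\Bigl(t-\sum_{l=1}^k\tau_l\Bigr)^{b_k-1},\qquad C(a,b,t)=\frac{1}{t^{\sum_{k=1}^n(a_k+b_k-1)}}\prod_{k=1}^n\frac{\Gamma\bigl(1+\sum_{l=k}^n(a_l+b_l-1)\bigr)}{\Gamma(a_k)\,\Gamma\bigl(b_k+\sum_{l=k+1}^n(a_l+b_l-1)\bigr)},$$ on the simplex $S_n=\{\tau\in\mathbb R^n:0<\tau_k<t-\sum_{l<k}\tau_l,\ k=1,\dots,n\}$. For $h,i\in\{0,1\}$ let $\mathbf X_d^{h,i,j}$ be the random walk in $\mathbb R^d$ with position at time $t>0$ $$\mathbf X_d^{h,i,j}(t)=c\sum_{k=1}^{\mathcal N(t)+1}\tau_k\mathbf V_k ,\qquad \tau_{\mathcal N(t)+1}:=t-\sum_{k=1}^{\mathcal N(t)}\tau_k,$$ where $\mathcal N(t)$ is the random number of changes of direction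 in $[0,t]$, the directions $\mathbf V_1,\mathbf V_2,\dots$ are independent, uniformly distributed on the unit sphere of $\mathbb R^d$ and independent of $\mathcal N(t)$ and of the time displacements, and, given $\mathcal N(t)=n\ge1$, the vector $(\tau_1,\dots,\tau_n)$ has the law $GD(a;b)$ with the following parameters: if $n\le j$, then $a=(d-1,\dots,d-1)$ and $b=(1,\dots,1,d-1)$; if $n>j$, then $$a_k=\begin{cases}d-1,&1\le k\le j,\\ \frac d2-1,&j<k\le n,\end{cases}\qquad b_k=\begin{cases}(n-j+1)(\frac d2-1)+i+h+1,&k=j,\\ \frac d2-i,&k=n,\\ 1,&\text{otherwise.}\end{cases}$$ Then, for fixed $j$, the four walks $\mathbf X_d^{0,0,j},\mathbf X_d^{1,0,j},\mathbf X_d^{0,1,j},\mathbf X_d^{1,1,j}$ are identically distributed at each time $t>0$: for every $n$, the conditional law of $\mathbf X_d^{h,i,j}(t)$ given $\mathcal N(t)=n$ (whenever this event has positive probability) does not depend on $h,i\in\{0,1\}$; consequently, if the numbers of changes of direction of the walks have the same law, then their positions at time $t$ have the same unconditional law. Moreover, for every $n>j$ such that $\mathcal N(t)=n$ has positive probability and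 every $\alpha\in\mathbb R^d\setminus\{0\}$, the conditional characteristic function is, with $\nu=(n+1)(\frac d2-1)+\frac j2$, $$\mathbf E\bigl\{e^{i\langle\alpha,\mathbf X_d^{h,i,j}(t)\rangle}\,\big|\,\mathcal N(t)=n\bigr\}=2^{\nu}\,\Gamma(\nu+1)\,\frac{J_{\nu}(ct\|\alpha\|)}{(ct\|\alpha\|)^{\nu}}$$ (in the exponent of $e$, the first $i$ is the imaginary unit), where $J_\nu(x)=\sum_{m\ge0}(-1)^m(x/2)^{2m+\nu}/(m!\,\Gamma(m+\nu+1))$ is the Bessel function. -/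

import Mathlib

open MeasureTheory ProbabilityTheory

noncomputable section

/-- The Bessel function `J_ν(x) = ∑_{m ≥ 0} (-1)^m (x/2)^(2m+ν) / (m! Γ(m+ν+1))`. -/
def besselJ (ν x : ℝ) : ℝ :=
  ∑' m : ℕ, (-1 : ℝ) ^ m * (x / 2) ^ (2 * (m : ℝ) + ν) /
    ((m.factorial : ℝ) * Real.Gamma ((m : ℝ) + ν + 1))

/-- The open simplex `S_n` of side `t`. The coordinate `k : Fin n` is `τ_{k+1}` in the usual
numbering from one. -/
def openSimplex (n : ℕ) (t : ℝ) : Set (Fin n → ℝ) :=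
  {τ | ∀ k, 0 < τ k ∧ τ k < t - ∑ l ∈ Finset.Iio k, τ l}

/-- The normalizing constant `C(a, b, t)` of the rescaled generalized Dirichlet density. -/
def genDirichletConst {n : ℕ} (a b : Fin n → ℝ) (t : ℝ) : ℝ :=
  1 / t ^ (∑ k, (a k + b k - 1)) *
    ∏ k, Real.Gamma (1 + ∑ l ∈ Finset.Ici k, (a l + b l - 1)) /
      (Real.Gamma (a k) * Real.Gamma (b k + ∑ l ∈ Finset.Ioi k, (a l + b l - 1)))

/-- The rescaled generalized Dirichlet density on the simplex `S_n`. -/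
def genDirichletDensity {n : ℕ} (a b : Fin n → ℝ) (t : ℝ) (τ : Fin n → ℝ) : ℝ :=
  genDirichletConst a b t *
    ∏ k, (τ k ^ (a k - 1) * (t - ∑ l ∈ Finset.Iic k, τ l) ^ (b k - 1))

/-- The rescaled generalized Dirichlet distribution `GD(a; b)` on the simplex `S_n`. -/
def genDirichlet {n : ℕ} (a b : Fin n → ℝ) (t : ℝ) : Measure (Fin n → ℝ) :=
  (volume.restrict (openSimplex n t)).withDensity
    (fun τ => ENNReal.ofReal (genDirichletDensity a b t τ))

/-- The uniform distribution on the unit sphere of `ℝ^d` (normalized surface measure), seen as a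
measure on `ℝ^d`. -/
def uniformSphere (d : ℕ) : Measure (EuclideanSpace ℝ (Fin d)) :=
  (((volume : Measure (EuclideanSpace ℝ (Fin d))).toSphere Set.univ)⁻¹ •
    (volume : Measure (EuclideanSpace ℝ (Fin d))).toSphere).map Subtype.val

/-- The parameter `a_k`, `1 ≤ k ≤ n`, of the walk with switching phase. -/
def switchA (d j n k : ℕ) : ℝ :=
  if n ≤ j then (d : ℝ) - 1
  else if k ≤ j then (d : ℝ) - 1
  else (d : ℝ) / 2 - 1

/-- The parameter `b_k`, `1 ≤ k ≤ n`, of the walk with switching phase. -/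
def switchB (d : ℕ) (h i : Fin 2) (j n k : ℕ) : ℝ :=
  if n ≤ j then (if k = n then (d : ℝ) - 1 else 1)
  else if k = j then
    ((n : ℝ) - (j : ℝ) + 1) * ((d : ℝ) / 2 - 1) + ((i : ℕ) : ℝ) + ((h : ℕ) : ℝ) + 1
  else if k = n then (d : ℝ) / 2 - ((i : ℕ) : ℝ)
  else 1

/-- The law of `(τ_1, …, τ_n)` for the walk `X_d^{h,i,j}` at time `t` given `n` changes of
direction. -/
def switchLaw (d : ℕ) (h i : Fin 2) (j n : ℕ) (t : ℝ) : Measure (Fin n → ℝ) :=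
  genDirichlet (fun k : Fin n => switchA d j n ((k : ℕ) + 1))
    (fun k : Fin n => switchB d h i j n ((k : ℕ) + 1)) t

/-- The duration of the `(k+1)`-st step, `0 ≤ k ≤ n`, when there are `n` changes of direction in
`[0, t]`: it is `τ_{k+1}` for `k < n`, and the remaining time `t - (τ_1 + … + τ_n)` for `k = n`. -/
def stepDuration (t : ℝ) (n : ℕ) (τ : ℕ → ℝ) (k : ℕ) : ℝ :=
  if k < n then τ k else t - ∑ l ∈ Finset.range n, τ l

/-- The position at time `t`, `c ∑_{k=1}^{n+1} τ_k V_k`. The sequences are numbered from zero: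
`τ k` is `τ_{k+1}` and `V k` is `V_{k+1}`. -/
def walkPosition {d : ℕ} (c t : ℝ) (n : ℕ) (τ : ℕ → ℝ) (V : ℕ → EuclideanSpace ℝ (Fin d)) :
    EuclideanSpace ℝ (Fin d) :=
  c • ∑ k ∈ Finset.range (n + 1), stepDuration t n τ k • V k

/-- The random variables `N` (number of changes of direction in `[0, t]`), `τ` (times between the
changes) and `V` (directions), on the probability space `(Ω, P)`, drive the walk `X_d^{h,i,j}` with
switching phase up to time `t`: the directions are i.i.d. uniform on the unit sphere and independent
of `(N, τ)`, and given `N = n` the vector `(τ_1, …, τ_n)` has the generalized Dirichlet law with the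
parameters of the walk. The law of `N` is arbitrary (it may be concentrated at a single `n`). -/
structure IsSwitchingWalk {Ω : Type*} [MeasurableSpace Ω] (P : Measure Ω)
    (d : ℕ) (h i : Fin 2) (j : ℕ) (t : ℝ)
    (N : Ω → ℕ) (τ : ℕ → Ω → ℝ) (V : ℕ → Ω → EuclideanSpace ℝ (Fin d)) : Prop where
  measurable_N : Measurable N
  measurable_tau : ∀ k, Measurable (τ k)
  measurable_V : ∀ k, Measurable (V k)
  law_V : ∀ k, P.map (V k) = uniformSphere d
  iIndep_V : iIndepFun V P
  indep_V : IndepFun (fun ω k => V k ω) (fun ω => (N ω, fun k => τ k ω)) P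
  law_tau : ∀ n : ℕ, 1 ≤ n → P (N ⁻¹' {n}) ≠ 0 →
    (cond P (N ⁻¹' {n})).map (fun ω (k : Fin n) => τ k ω) = switchLaw d h i j n t

end

/-! Write μ = d/2 - 1 and let Λ_ν be the normalized Bessel function `besselN ν`. The uniform law on
the sphere has characteristic function Λ_μ(‖ξ‖) (`charFun_uniformSphere`), so averaging over the
directions leaves the product of Λ_μ(c‖α‖τ_k) over the n + 1 steps, to be integrated against the
generalized Dirichlet law. Peeling off the first step s leaves an integral of the same kind on a
simplex of side t - s. The whole integral is thus an iterated convolution of s^(A-1) Λ_μ(s) with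
(t-s)^(B-1) Λ_ν(t-s) (`BesselDirichlet.succ`).

Such a convolution is a constant times t^(A+B-1) Λ_κ(t) in two pairs of cases: A = μ with B = ν + 1
or ν, where κ = μ + ν; and A = 2μ + 1 with B = 2ν + 1 or 2ν + 2, where κ = μ + ν + 1/2. On power
series coefficients these are the Rothe–Hagen and Chu–Vandermonde identities. The parameter i
chooses within the first pair and h within the second; as κ is the same in both members of a pair,
neither reaches the final index (n+1)μ + j/2, in which each of the j steps before the switch
contributes an extra 1/2.

The Gamma constants of the density are never evaluated: the value at frequency zero fixes the factor
(`BesselDirichlet.integral_stepProd`). For n ≤ j the parameters do not involve h and i at all. -/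

noncomputable section

/-! ### Rising factorials and convolution of polynomial sequences. -/

/-- The rising factorial `x (x + 1) ⋯ (x + n - 1)`. -/
def risingFac (x : ℝ) (n : ℕ) : ℝ := (ascPochhammer ℝ n).eval x

@[simp] lemma risingFac_zero (x : ℝ) : risingFac x 0 = 1 := by simp [risingFac]

lemma risingFac_succ (x : ℝ) (n : ℕ) : risingFac x (n + 1) = risingFac x n * (x + n) :=
  ascPochhammer_succ_eval n x

lemma risingFac_succ_left (x : ℝ) (n : ℕ) : risingFac x (n + 1) = x * risingFac (x + 1) n := by
  simp [risingFac, ascPochhammer_succ_left]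

lemma risingFac_add (x : ℝ) (n m : ℕ) :
    risingFac x (n + m) = risingFac x n * risingFac (x + n) m := by
  rw [risingFac, ← ascPochhammer_mul]; simp [risingFac]

lemma risingFac_pos {x : ℝ} (hx : 0 < x) (n : ℕ) : 0 < risingFac x n := ascPochhammer_pos n x hx

/-- Among the factors 2x + k, even k give 2^n (x)_n and odd k give 2^n (x + 1/2)_n. -/
lemma risingFac_two_mul (x : ℝ) (n : ℕ) :
    risingFac (2 * x) (2 * n) = 4 ^ n * risingFac x n * risingFac (x + 1 / 2) n := by
  induction n with
  | zero => simp
  | succ n ih =>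
    rw [show 2 * (n + 1) = 2 * n + 1 + 1 by ring, risingFac_succ, risingFac_succ, ih,
      risingFac_succ, risingFac_succ]
    push_cast
    ring

lemma Gamma_add_natCast {x : ℝ} (hx : 0 < x) (n : ℕ) :
    Real.Gamma (x + n) = risingFac x n * Real.Gamma x := by
  induction n with
  | zero => simp
  | succ n ih =>
    rw [show x + ((n + 1 : ℕ) : ℝ) = x + n + 1 by push_cast; ring,
      Real.Gamma_add_one (by positivity), ih, risingFac_succ]
    ring

/-- A convolution identity for polynomial families obeying the same difference equation; it
contains the Chu–Vandermonde and the Rothe–Hagen identities. -/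
theorem sum_antidiagonal_eval_mul_eval (a b : ℕ → Polynomial ℝ) (s : ℝ)
    (ha : a 0 = 1) (hb : b 0 = 1) (ha0 : ∀ m, (a (m + 1)).eval 0 = 0)
    (has : ∀ m x, (a (m + 1)).eval (x + 1) - (a (m + 1)).eval x = (a m).eval (x + s))
    (hbs : ∀ m x, (b (m + 1)).eval (x + 1) - (b (m + 1)).eval x = (b m).eval (x + s))
    (m : ℕ) (x y : ℝ) :
    ∑ p ∈ Finset.HasAntidiagonal.antidiagonal m, (a p.1).eval x * (b p.2).eval y = (b m).eval (x + y) := by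
  induction m generalizing x with
  | zero => simp [ha, hb]
  | succ m ih =>
    -- F is the difference of the two sides as a polynomial in x, with y fixed. The induction
    -- hypothesis at z + s makes it 1-periodic, and `ha0` makes it vanish at 0; hence it vanishes on
    -- ℕ and is zero.
    set F : Polynomial ℝ := ∑ p ∈ Finset.HasAntidiagonal.antidiagonal (m + 1),
      a p.1 * Polynomial.C ((b p.2).eval y) - (b (m + 1)).comp (Polynomial.X + Polynomial.C y)
      with hF
    have hev : ∀ z, F.eval z = ∑ p ∈ Finset.HasAntidiagonal.antidiagonal (m + 1),
        (a p.1).eval z * (b p.2).eval y - (b (m + 1)).eval (z + y) := by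
      intro z; simp [hF, Polynomial.eval_finsetSum]
    have hstep : ∀ z, F.eval (z + 1) = F.eval z := by
      intro z
      have h1 := ih (z + s)
      have h2 := hbs m (z + y)
      rw [hev, hev, Finset.Nat.sum_antidiagonal_succ, Finset.Nat.sum_antidiagonal_succ]
      simp only [ha, Polynomial.eval_one]
      have h3 : ∑ p ∈ Finset.HasAntidiagonal.antidiagonal m, (a (p.1 + 1)).eval (z + 1) * (b p.2).eval y
          - ∑ p ∈ Finset.HasAntidiagonal.antidiagonal m, (a (p.1 + 1)).eval z * (b p.2).eval y
          = (b m).eval (z + s + y) := by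
        rw [← h1, ← Finset.sum_sub_distrib]
        exact Finset.sum_congr rfl fun p _ => by rw [← sub_mul, has]
      rw [show z + 1 + y = z + y + 1 by ring]
      rw [show z + s + y = z + y + s by ring] at h3
      linarith
    have hnat : ∀ n : ℕ, F.eval (n : ℝ) = 0 := by
      intro n
      induction n with
      | zero =>
        rw [hev, Finset.Nat.sum_antidiagonal_succ]
        simp [ha, ha0]
      | succ n ih => rw [Nat.cast_succ, hstep, ih]
    have hzero : F = 0 := Polynomial.eq_zero_of_infinite_isRoot F
      ((Set.infinite_range_of_injective Nat.cast_injective).mono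
        (Set.range_subset_iff.2 hnat))
    have := hev x
    rw [hzero, Polynomial.eval_zero] at this
    linarith

/-! ### Bessel coefficients, Rothe–Hagen and Chu–Vandermonde. -/

/-- The coefficients `1 / (m! (ν+1)_m)` of the normalized Bessel function. -/
def besselCoeff (ν : ℝ) (m : ℕ) : ℝ := 1 / (m.factorial * risingFac (ν + 1) m)

/-- The polynomial `(x)_m / m!`. -/
def vandermondePoly (m : ℕ) : Polynomial ℝ :=
  Polynomial.C (1 / (m.factorial : ℝ)) * ascPochhammer ℝ m

/-- The polynomial `binom(x + 2m, m)`. -/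
def hagenPoly (m : ℕ) : Polynomial ℝ :=
  Polynomial.C (1 / (m.factorial : ℝ)) *
    (ascPochhammer ℝ m).comp (Polynomial.X + Polynomial.C ((m : ℝ) + 1))

/-- The polynomial `x / (x + 2m) binom(x + 2m, m)`. -/
def rothePoly : ℕ → Polynomial ℝ
  | 0 => 1
  -- The denominator x + 2(m+1) has been cancelled against the top factor of the binomial, which
  -- keeps this a polynomial.
  | m + 1 => Polynomial.C (1 / ((m + 1).factorial : ℝ)) * Polynomial.X *
      (ascPochhammer ℝ m).comp (Polynomial.X + Polynomial.C ((m : ℝ) + 2))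

lemma eval_vandermondePoly (m : ℕ) (x : ℝ) :
    (vandermondePoly m).eval x = risingFac x m / m.factorial := by
  simp [vandermondePoly, risingFac]; ring

lemma eval_hagenPoly (m : ℕ) (x : ℝ) :
    (hagenPoly m).eval x = risingFac (x + m + 1) m / m.factorial := by
  simp [hagenPoly, risingFac, add_assoc]; ring

lemma eval_rothePoly_succ (m : ℕ) (x : ℝ) :
    (rothePoly (m + 1)).eval x = x * risingFac (x + m + 2) m / (m + 1).factorial := by
  simp [rothePoly, risingFac, add_assoc]; ring

lemma vandermondePoly_difference (m : ℕ) (x : ℝ) :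
    (vandermondePoly (m + 1)).eval (x + 1) - (vandermondePoly (m + 1)).eval x =
      (vandermondePoly m).eval (x + 1) := by
  have : (m.factorial : ℝ) ≠ 0 := by positivity
  simp only [eval_vandermondePoly, Nat.factorial_succ]
  rw [risingFac_succ, risingFac_succ_left]
  push_cast
  field_simp
  ring

lemma hagenPoly_difference (m : ℕ) (x : ℝ) :
    (hagenPoly (m + 1)).eval (x + 1) - (hagenPoly (m + 1)).eval x =
      (hagenPoly m).eval (x + 2) := by
  have : (m.factorial : ℝ) ≠ 0 := by positivity
  simp only [eval_hagenPoly, Nat.factorial_succ]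
  rw [risingFac_succ, risingFac_succ_left]
  push_cast
  rw [show x + 1 + (m + 1) + 1 = x + m + 3 by ring, show x + (m + 1) + 1 + 1 = x + m + 3 by ring,
    show x + 2 + m + 1 = x + m + 3 by ring]
  field_simp
  ring

lemma rothePoly_difference (m : ℕ) (x : ℝ) :
    (rothePoly (m + 1)).eval (x + 1) - (rothePoly (m + 1)).eval x =
      (rothePoly m).eval (x + 2) := by
  cases m with
  | zero => simp [rothePoly]
  | succ k =>
    have : (k.factorial : ℝ) ≠ 0 := by positivity
    simp only [eval_rothePoly_succ, Nat.factorial_succ]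
    rw [risingFac_succ, risingFac_succ_left]
    push_cast
    rw [show x + 1 + (k + 1) + 2 = x + k + 4 by ring, show x + (k + 1) + 2 + 1 = x + k + 4 by ring,
      show x + 2 + k + 2 = x + k + 4 by ring]
    field_simp
    ring

lemma vandermonde_risingFac (m : ℕ) (x y : ℝ) :
    ∑ p ∈ Finset.HasAntidiagonal.antidiagonal m, (risingFac x p.1 / p.1.factorial) * (risingFac y p.2 / p.2.factorial)
      = risingFac (x + y) m / m.factorial := by
  simp only [← eval_vandermondePoly]
  refine sum_antidiagonal_eval_mul_eval _ _ 1 ?_ ?_ ?_ vandermondePoly_difference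
    vandermondePoly_difference m x y
  · simp [vandermondePoly]
  · simp [vandermondePoly]
  · intro m; rw [eval_vandermondePoly, risingFac_succ_left]; simp

/-- Only the first factor of the convolution has to vanish at 0, so the second may be either family
of shift 2; the sum is of the type of the second. -/
lemma rothe_hagen (m : ℕ) (x y : ℝ) :
    ∑ p ∈ Finset.HasAntidiagonal.antidiagonal m, (rothePoly p.1).eval x * (hagenPoly p.2).eval y
      = (hagenPoly m).eval (x + y) := by
  refine sum_antidiagonal_eval_mul_eval _ _ 2 rfl ?_ ?_ rothePoly_difference
    hagenPoly_difference m x y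
  · simp [hagenPoly]
  · intro m; rw [eval_rothePoly_succ]; simp

lemma rothe_rothe (m : ℕ) (x y : ℝ) :
    ∑ p ∈ Finset.HasAntidiagonal.antidiagonal m, (rothePoly p.1).eval x * (rothePoly p.2).eval y
      = (rothePoly m).eval (x + y) := by
  refine sum_antidiagonal_eval_mul_eval _ _ 2 rfl rfl ?_ rothePoly_difference
    rothePoly_difference m x y
  intro m; rw [eval_rothePoly_succ]; simp

/-- The denominator (μ+1)_p of the Bessel coefficient cancels inside (μ)_{2p} = μ (μ+1)_p
(μ+p+1)_{p-1}, for p ≥ 1. -/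
lemma besselCoeff_mul_risingFac_self {μ : ℝ} (hμ : 0 < μ) (p : ℕ) :
    besselCoeff μ p * risingFac μ (2 * p) = (rothePoly p).eval μ := by
  cases p with
  | zero => simp [besselCoeff, rothePoly]
  | succ k =>
    have := (risingFac_pos (x := μ + 1) (by positivity) (k + 1)).ne'
    have h2 : ((k + 1).factorial : ℝ) ≠ 0 := by positivity
    rw [eval_rothePoly_succ, besselCoeff, show 2 * (k + 1) = (k + 1 + k) + 1 by ring,
      risingFac_succ_left μ, risingFac_add (μ + 1) (k + 1) k]
    push_cast
    rw [show μ + 1 + (k + 1) = μ + k + 2 by ring]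
    field_simp

lemma besselCoeff_mul_risingFac_add_one {ν : ℝ} (hν : 0 < ν) (p : ℕ) :
    besselCoeff ν p * risingFac (ν + 1) (2 * p) = (hagenPoly p).eval ν := by
  have := (risingFac_pos (x := ν + 1) (by positivity) p).ne'
  have h2 : (p.factorial : ℝ) ≠ 0 := by positivity
  rw [eval_hagenPoly, besselCoeff, two_mul, risingFac_add, show ν + 1 + p = ν + p + 1 by ring]
  field_simp

/-- The duplication formula splits (2ν+1)_{2p} and one of the halves, (ν+1)_p, cancels the
denominator. -/
lemma besselCoeff_mul_risingFac_two_mul_add_one {ν : ℝ} (hν : 0 < ν) (p : ℕ) :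
    besselCoeff ν p * risingFac (2 * ν + 1) (2 * p) =
      4 ^ p * (risingFac (ν + 1 / 2) p / p.factorial) := by
  have := (risingFac_pos (x := ν + 1) (by positivity) p).ne'
  have h2 : (p.factorial : ℝ) ≠ 0 := by positivity
  rw [show 2 * ν + 1 = 2 * (ν + 1 / 2) by ring, risingFac_two_mul, besselCoeff,
    show ν + 1 / 2 + 1 / 2 = ν + 1 by ring]
  field_simp

lemma besselCoeff_mul_risingFac_two_mul_add_two {ν : ℝ} (hν : 0 < ν) (p : ℕ) :
    besselCoeff ν p * risingFac (2 * ν + 2) (2 * p) =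
      4 ^ p * (risingFac (ν + 3 / 2) p / p.factorial) := by
  have := (risingFac_pos (x := ν + 1) (by positivity) p).ne'
  have h2 : (p.factorial : ℝ) ≠ 0 := by positivity
  rw [show 2 * ν + 2 = 2 * (ν + 1) by ring, risingFac_two_mul, besselCoeff,
    show ν + 1 + 1 / 2 = ν + 3 / 2 by ring]
  field_simp

/-- The coefficient form of
`∫₀ᵗ s^(A-1) Λ_μ(s) (t-s)^(B-1) Λ_ν(t-s) ds = B(A, B) t^(A+B-1) Λ_κ(t)`, where
`Λ_ν` is the normalized Bessel function. -/
def BesselCompatible (μ A ν B κ : ℝ) : Prop :=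
  ∀ m : ℕ, ∑ p ∈ Finset.HasAntidiagonal.antidiagonal m,
    (besselCoeff μ p.1 * risingFac A (2 * p.1)) * (besselCoeff ν p.2 * risingFac B (2 * p.2)) =
      besselCoeff κ m * risingFac (A + B) (2 * m)

/-- In this lemma and the next three, A + B is to κ as B is to ν (κ + 1, κ, 2κ + 1, 2κ + 2), so the
right-hand side is again a coefficient of the same family. -/
lemma besselCompatible_add_one {μ ν : ℝ} (hμ : 0 < μ) (hν : 0 < ν) :
    BesselCompatible μ μ ν (ν + 1) (μ + ν) := fun m => by
  simp only [besselCoeff_mul_risingFac_self hμ, besselCoeff_mul_risingFac_add_one hν]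
  rw [rothe_hagen, ← besselCoeff_mul_risingFac_add_one (by positivity), add_assoc]

lemma besselCompatible_self {μ ν : ℝ} (hμ : 0 < μ) (hν : 0 < ν) :
    BesselCompatible μ μ ν ν (μ + ν) := fun m => by
  simp only [besselCoeff_mul_risingFac_self hμ, besselCoeff_mul_risingFac_self hν]
  rw [rothe_rothe, ← besselCoeff_mul_risingFac_self (by positivity)]

lemma besselCompatible_two_mul_add_one {μ ν : ℝ} (hμ : 0 < μ) (hν : 0 < ν) :
    BesselCompatible μ (2 * μ + 1) ν (2 * ν + 1) (μ + ν + 1 / 2) := fun m => by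
  simp only [besselCoeff_mul_risingFac_two_mul_add_one hμ,
    besselCoeff_mul_risingFac_two_mul_add_one hν]
  rw [show 2 * μ + 1 + (2 * ν + 1) = 2 * (μ + ν + 1 / 2) + 1 by ring,
    besselCoeff_mul_risingFac_two_mul_add_one (by positivity),
    show μ + ν + 1 / 2 + 1 / 2 = (μ + 1 / 2) + (ν + 1 / 2) by ring, ← vandermonde_risingFac,
    Finset.mul_sum]
  refine Finset.sum_congr rfl fun p hp => ?_
  rw [← Finset.HasAntidiagonal.mem_antidiagonal.1 hp, pow_add]
  ring

lemma besselCompatible_two_mul_add_two {μ ν : ℝ} (hμ : 0 < μ) (hν : 0 < ν) :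
    BesselCompatible μ (2 * μ + 1) ν (2 * ν + 2) (μ + ν + 1 / 2) := fun m => by
  simp only [besselCoeff_mul_risingFac_two_mul_add_one hμ,
    besselCoeff_mul_risingFac_two_mul_add_two hν]
  rw [show 2 * μ + 1 + (2 * ν + 2) = 2 * (μ + ν + 1 / 2) + 2 by ring,
    besselCoeff_mul_risingFac_two_mul_add_two (by positivity),
    show μ + ν + 1 / 2 + 3 / 2 = (μ + 1 / 2) + (ν + 3 / 2) by ring, ← vandermonde_risingFac,
    Finset.mul_sum]
  refine Finset.sum_congr rfl fun p hp => ?_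
  rw [← Finset.HasAntidiagonal.mem_antidiagonal.1 hp, pow_add]
  ring

lemma one_le_risingFac {x : ℝ} (hx : 1 ≤ x) (n : ℕ) : 1 ≤ risingFac x n := by
  induction n with
  | zero => simp
  | succ n ih =>
    rw [risingFac_succ]
    exact one_le_mul_of_one_le_of_one_le ih (le_add_of_le_of_nonneg hx n.cast_nonneg)

lemma besselCoeff_pos {ν : ℝ} (hν : 0 < ν) (m : ℕ) : 0 < besselCoeff ν m := by
  have := risingFac_pos (x := ν + 1) (by positivity) m
  unfold besselCoeff; positivity

lemma besselCoeff_le {ν : ℝ} (hν : 0 < ν) (m : ℕ) : besselCoeff ν m ≤ 1 / m.factorial := by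
  have := one_le_risingFac (x := ν + 1) (by linarith) m
  have h2 : (0 : ℝ) < m.factorial := by positivity
  exact one_div_le_one_div_of_le h2 (le_mul_of_one_le_right h2.le this)

/-! ### The normalized Bessel function as a power series. -/

/-- The normalized Bessel function `2^ν Γ(ν+1) J_ν(x) / x^ν`, extended to all `x`. -/
def besselN (ν x : ℝ) : ℝ := ∑' m : ℕ, besselCoeff ν m * (-(x ^ 2 / 4)) ^ m

lemma summable_norm_besselN {ν : ℝ} (hν : 0 < ν) (q : ℝ) :
    Summable fun m : ℕ => ‖besselCoeff ν m * q ^ m‖ := by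
  refine Summable.of_nonneg_of_le (fun m => norm_nonneg _) (fun m => ?_)
    (Real.summable_pow_div_factorial |q|)
  rw [norm_mul, norm_pow, Real.norm_eq_abs, Real.norm_eq_abs, abs_of_pos (besselCoeff_pos hν m),
    div_eq_mul_one_div, mul_comm]
  exact mul_le_mul_of_nonneg_left (besselCoeff_le hν m) (by positivity)

lemma hasSum_besselN {ν : ℝ} (hν : 0 < ν) (x : ℝ) :
    HasSum (fun m : ℕ => besselCoeff ν m * (-(x ^ 2 / 4)) ^ m) (besselN ν x) :=
  (summable_norm_besselN hν _).of_norm.hasSum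

@[simp] lemma besselN_zero (ν : ℝ) : besselN ν 0 = 1 := by
  rw [besselN, tsum_eq_single 0]
  · simp [besselCoeff]
  · intro m hm; simp [hm]

lemma continuous_besselN {ν : ℝ} (hν : 0 < ν) : Continuous (besselN ν) := by
  rw [continuous_iff_continuousAt]
  intro x
  have h : ContinuousOn (besselN ν) (Metric.ball 0 (|x| + 1)) := by
    refine continuousOn_tsum (u := fun m => ‖besselCoeff ν m * ((|x| + 1) ^ 2 / 4) ^ m‖)
      (fun m => by fun_prop) (summable_norm_besselN hν _) (fun m y hy => ?_)
    have hy' : |y| ≤ |x| + 1 := by simpa using (Metric.mem_ball.1 hy).le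
    rw [norm_mul, norm_mul, norm_pow, norm_pow, norm_neg]
    refine mul_le_mul_of_nonneg_left (pow_le_pow_left₀ (norm_nonneg _) ?_ m) (norm_nonneg _)
    rw [Real.norm_of_nonneg (by positivity), Real.norm_of_nonneg (by positivity)]
    have := pow_le_pow_left₀ (abs_nonneg y) hy' 2
    rw [sq_abs] at this
    linarith
  exact h.continuousAt (Metric.isOpen_ball.mem_nhds (by simp))

/-- The normalized Bessel function in terms of the Bessel function. -/
lemma two_rpow_mul_Gamma_mul_besselJ {ν x : ℝ} (hν : 0 < ν) (hx : 0 < x) :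
    2 ^ ν * Real.Gamma (ν + 1) * (besselJ ν x / x ^ ν) = besselN ν x := by
  rw [besselN, besselJ, ← tsum_div_const, ← tsum_mul_left]
  refine tsum_congr fun m => ?_
  have h1 : Real.Gamma ((m : ℝ) + ν + 1) = risingFac (ν + 1) m * Real.Gamma (ν + 1) := by
    rw [← Gamma_add_natCast (by positivity)]; congr 1; ring
  have h2 : (x / 2) ^ (2 * (m : ℝ) + ν) = (x ^ 2 / 4) ^ m * (x ^ ν / 2 ^ ν) := by
    rw [Real.rpow_add (by positivity), Real.div_rpow hx.le zero_le_two ν,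
      show 2 * (m : ℝ) = ((2 * m : ℕ) : ℝ) by push_cast; ring, Real.rpow_natCast, pow_mul]
    congr 2; ring
  have h3 := (risingFac_pos (x := ν + 1) (by positivity) m).ne'
  have h4 : (m.factorial : ℝ) ≠ 0 := by positivity
  have h5 := (Real.Gamma_pos_of_pos (s := ν + 1) (by positivity)).ne'
  have h6 : x ^ ν ≠ 0 := (Real.rpow_pos_of_pos hx _).ne'
  have h7 : (2 : ℝ) ^ ν ≠ 0 := (Real.rpow_pos_of_pos two_pos _).ne'
  rw [h1, h2, besselCoeff, neg_pow (x ^ 2 / 4)]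
  field_simp

/-! ### Beta integrals and convolution of Bessel functions. -/

/-- The beta integral on `(0, t)`. -/
lemma setIntegral_rpow_mul_sub_rpow {A B t : ℝ} (hA : 0 < A) (hB : 0 < B) (ht : 0 < t) :
    ∫ s in Set.Ioo 0 t, s ^ (A - 1) * (t - s) ^ (B - 1) = beta A B * t ^ (A + B - 1) := by
  have h := Complex.betaIntegral_scaled A B ht
  rw [Complex.betaIntegral_eq_Gamma_mul_div _ _ (by simpa) (by simpa),
    intervalIntegral.integral_of_le ht.le, integral_Ioc_eq_integral_Ioo] at h
  have h2 : ∫ s in Set.Ioo 0 t, (s : ℂ) ^ ((A : ℂ) - 1) * ((t : ℂ) - s) ^ ((B : ℂ) - 1) =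
      ((∫ s in Set.Ioo 0 t, s ^ (A - 1) * (t - s) ^ (B - 1) : ℝ) : ℂ) := by
    rw [← integral_complex_ofReal]
    refine setIntegral_congr_fun measurableSet_Ioo fun s hs => ?_
    simp only [Complex.ofReal_mul]
    have h3 : ((t - s : ℝ) : ℂ) = (t : ℂ) - s := by push_cast; rfl
    rw [← h3, show (A : ℂ) - 1 = ((A - 1 : ℝ) : ℂ) by push_cast; rfl,
      show (B : ℂ) - 1 = ((B - 1 : ℝ) : ℂ) by push_cast; rfl,
      ← Complex.ofReal_cpow hs.1.le, ← Complex.ofReal_cpow (by linarith [hs.2])]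
  rw [h2, show (A : ℂ) + B - 1 = ((A + B - 1 : ℝ) : ℂ) by push_cast; rfl,
    ← Complex.ofReal_cpow ht.le, ← Complex.ofReal_add, Complex.Gamma_ofReal, Complex.Gamma_ofReal,
    Complex.Gamma_ofReal] at h
  rw [beta, mul_comm]
  exact_mod_cast h

lemma integrableOn_rpow_mul_sub_rpow {A B t : ℝ} (hA : 0 < A) (hB : 0 < B) (ht : 0 < t) :
    IntegrableOn (fun s => s ^ (A - 1) * (t - s) ^ (B - 1)) (Set.Ioo 0 t) := by
  -- A non-integrable function has integral 0 by convention, whereas the beta integral is positive.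
  by_contra h
  have h1 := integral_undef h
  rw [setIntegral_rpow_mul_sub_rpow hA hB ht] at h1
  exact (mul_pos (beta_pos hA hB) (Real.rpow_pos_of_pos ht _)).ne' h1

lemma beta_add_natCast {A B : ℝ} (hA : 0 < A) (hB : 0 < B) (p q : ℕ) :
    beta (A + p) (B + q) = beta A B * risingFac A p * risingFac B q / risingFac (A + B) (p + q) := by
  rw [beta, beta, Gamma_add_natCast hA, Gamma_add_natCast hB,
    show A + p + (B + q) = A + B + ((p + q : ℕ) : ℝ) by push_cast; ring,
    Gamma_add_natCast (by positivity)]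
  have := (risingFac_pos (x := A + B) (by positivity) (p + q)).ne'
  have := (Real.Gamma_pos_of_pos (s := A + B) (by positivity)).ne'
  field_simp

/-- Convolution of power-weighted normalized Bessel functions. -/
theorem setIntegral_besselN_mul_besselN {μ A ν B κ : ℝ} (hμ : 0 < μ) (hA : 0 < A) (hν : 0 < ν)
    (hB : 0 < B) (h : BesselCompatible μ A ν B κ) {t : ℝ} (ht : 0 < t) (r : ℝ) :
    ∫ s in Set.Ioo 0 t, s ^ (A - 1) * (t - s) ^ (B - 1) *
        (besselN μ (r * s) * besselN ν (r * (t - s))) =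
      beta A B * t ^ (A + B - 1) * besselN κ (r * t) := by
  set q : ℝ := -(r ^ 2 / 4) with hq
  -- G is the Cauchy product of the two Bessel series; M bounds it termwise on (0, t), by replacing
  -- s and t - s with t.
  set G : ℕ → ℝ → ℝ := fun m s => ∑ p ∈ Finset.HasAntidiagonal.antidiagonal m,
    (besselCoeff μ p.1 * (q * s ^ 2) ^ p.1) * (besselCoeff ν p.2 * (q * (t - s) ^ 2) ^ p.2) with hG
  set M : ℕ → ℝ := fun m => ∑ p ∈ Finset.HasAntidiagonal.antidiagonal m,
    ‖besselCoeff μ p.1 * (q * t ^ 2) ^ p.1‖ * ‖besselCoeff ν p.2 * (q * t ^ 2) ^ p.2‖ with hM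
  have hMsum : Summable M := by
    have h1 := summable_norm_besselN hμ (q * t ^ 2)
    have h2 := summable_norm_besselN hν (q * t ^ 2)
    have h3 := h1.mul_of_nonneg h2 (fun _ => norm_nonneg _) (fun _ => norm_nonneg _)
    exact summable_sum_mul_antidiagonal_of_summable_mul (A := ℕ)
      (f := fun m => ‖besselCoeff μ m * (q * t ^ 2) ^ m‖)
      (g := fun m => ‖besselCoeff ν m * (q * t ^ 2) ^ m‖) h3
  have hsum : HasSum (fun m => ∫ s in Set.Ioo 0 t, s ^ (A - 1) * (t - s) ^ (B - 1) * G m s)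
      (∫ s in Set.Ioo 0 t, s ^ (A - 1) * (t - s) ^ (B - 1) *
        (besselN μ (r * s) * besselN ν (r * (t - s)))) := by
    refine hasSum_integral_of_dominated_convergence
      (fun m s => s ^ (A - 1) * (t - s) ^ (B - 1) * M m) (fun m => ?_) (fun m => ?_) ?_ ?_ ?_
    · exact Measurable.aestronglyMeasurable (by fun_prop)
    · refine (ae_restrict_iff' measurableSet_Ioo).2 (.of_forall fun s hs => ?_)
      have hs0 : 0 ≤ t - s := by linarith [hs.2]
      have hs1 : 0 ≤ s := hs.1.le
      rw [norm_mul, Real.norm_of_nonneg (mul_nonneg (Real.rpow_nonneg hs1 _)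
        (Real.rpow_nonneg hs0 _))]
      refine mul_le_mul_of_nonneg_left ((norm_sum_le _ _).trans (Finset.sum_le_sum fun p _ => ?_))
        (mul_nonneg (Real.rpow_nonneg hs1 _) (Real.rpow_nonneg hs0 _))
      rw [norm_mul]
      have key : ∀ (c u : ℝ) (k : ℕ), 0 ≤ u → u ≤ t →
          ‖c * (q * u ^ 2) ^ k‖ ≤ ‖c * (q * t ^ 2) ^ k‖ := by
        intro c u k hu hut
        simp only [norm_mul, norm_pow, Real.norm_of_nonneg hu, Real.norm_of_nonneg ht.le]
        gcongr
      exact mul_le_mul (key _ _ _ hs1 hs.2.le) (key _ _ _ hs0 (by linarith))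
        (norm_nonneg _) (norm_nonneg _)
    · exact .of_forall fun s => hMsum.mul_left _
    · simp_rw [tsum_mul_left]
      exact (integrableOn_rpow_mul_sub_rpow hA hB ht).mul_const _
    · refine .of_forall fun s => HasSum.mul_left _ ?_
      have e1 : ∀ u, -((r * u) ^ 2 / 4) = q * u ^ 2 := fun u => by rw [hq]; ring
      have s1 := summable_norm_besselN hμ (q * s ^ 2)
      have s2 := summable_norm_besselN hν (q * (t - s) ^ 2)
      rw [besselN, besselN, e1, e1,
        tsum_mul_tsum_eq_tsum_sum_antidiagonal_of_summable_norm s1 s2]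
      exact (summable_norm_sum_mul_antidiagonal_of_summable_norm s1 s2).of_norm.hasSum
  have hterm : ∀ m, ∫ s in Set.Ioo 0 t, s ^ (A - 1) * (t - s) ^ (B - 1) * G m s =
      beta A B * t ^ (A + B - 1) * (besselCoeff κ m * (-((r * t) ^ 2 / 4)) ^ m) := by
    intro m
    have hI : ∀ p ∈ Finset.HasAntidiagonal.antidiagonal m, ∀ s ∈ Set.Ioo 0 t,
        s ^ (A - 1) * (t - s) ^ (B - 1) * ((besselCoeff μ p.1 * (q * s ^ 2) ^ p.1) *
          (besselCoeff ν p.2 * (q * (t - s) ^ 2) ^ p.2)) =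
        besselCoeff μ p.1 * besselCoeff ν p.2 * q ^ m *
          (s ^ (A + (2 * p.1 : ℕ) - 1) * (t - s) ^ (B + (2 * p.2 : ℕ) - 1)) := by
      intro p hp s hs
      have hs0 : 0 < t - s := by linarith [hs.2]
      rw [← Finset.HasAntidiagonal.mem_antidiagonal.1 hp, pow_add,
        show A + ((2 * p.1 : ℕ) : ℝ) - 1 = A - 1 + (2 * p.1 : ℕ) by ring,
        show B + ((2 * p.2 : ℕ) : ℝ) - 1 = B - 1 + (2 * p.2 : ℕ) by ring,
        Real.rpow_add hs.1, Real.rpow_add hs0, Real.rpow_natCast, Real.rpow_natCast, pow_mul,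
        pow_mul, mul_pow, mul_pow]
      ring
    have hB' : ∀ p : ℕ × ℕ, IntegrableOn (fun s => besselCoeff μ p.1 * besselCoeff ν p.2 * q ^ m *
          (s ^ (A + (2 * p.1 : ℕ) - 1) * (t - s) ^ (B + (2 * p.2 : ℕ) - 1))) (Set.Ioo 0 t) :=
      fun p => (integrableOn_rpow_mul_sub_rpow (by positivity) (by positivity) ht).const_mul _
    rw [setIntegral_congr_fun measurableSet_Ioo (g := fun s =>
      ∑ p ∈ Finset.HasAntidiagonal.antidiagonal m, besselCoeff μ p.1 * besselCoeff ν p.2 * q ^ m *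
          (s ^ (A + (2 * p.1 : ℕ) - 1) * (t - s) ^ (B + (2 * p.2 : ℕ) - 1)))
      (fun s hs => by
        simp only [hG, Finset.mul_sum]
        exact Finset.sum_congr rfl fun p hp => hI p hp s hs),
      integral_finsetSum _ fun p _ => hB' p]
    have hR := (risingFac_pos (x := A + B) (by positivity) (2 * m)).ne'
    -- The even powers of s and t - s shift the beta parameters by 2p.1 and 2p.2. The resulting
    -- denominator (A+B)_{2m} depends on m only, so the remaining sum is the one in
    -- `BesselCompatible`.
    have hterm' : ∀ p ∈ Finset.HasAntidiagonal.antidiagonal m,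
        ∫ s in Set.Ioo 0 t, besselCoeff μ p.1 * besselCoeff ν p.2 * q ^ m *
          (s ^ (A + (2 * p.1 : ℕ) - 1) * (t - s) ^ (B + (2 * p.2 : ℕ) - 1)) =
        (beta A B * t ^ (A + B - 1) * (q * t ^ 2) ^ m / risingFac (A + B) (2 * m)) *
          ((besselCoeff μ p.1 * risingFac A (2 * p.1)) *
            (besselCoeff ν p.2 * risingFac B (2 * p.2))) := by
      intro p hp
      have hp' := Finset.HasAntidiagonal.mem_antidiagonal.1 hp
      rw [integral_const_mul, setIntegral_rpow_mul_sub_rpow (by positivity) (by positivity) ht,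
        beta_add_natCast hA hB, show 2 * p.1 + 2 * p.2 = 2 * m by omega,
        show A + ((2 * p.1 : ℕ) : ℝ) + (B + (2 * p.2 : ℕ)) - 1 = (A + B - 1) + (2 * m : ℕ) by
          rw [← hp']; push_cast; ring,
        Real.rpow_add ht, Real.rpow_natCast, pow_mul, mul_pow]
      ring
    rw [Finset.sum_congr rfl hterm', ← Finset.mul_sum, h m,
      show -((r * t) ^ 2 / 4) = q * t ^ 2 by rw [hq]; ring]
    field_simp
  simp_rw [hterm] at hsum
  rw [← hsum.tsum_eq, tsum_mul_left, besselN]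

/-! ### Generalized Dirichlet integrals by recursion on the simplex. -/

lemma measurableSet_openSimplex (n : ℕ) (t : ℝ) : MeasurableSet (openSimplex n t) := by
  have : openSimplex n t =
      ⋂ k, ({τ | 0 < τ k} ∩ {τ | τ k < t - ∑ l ∈ Finset.Iio k, τ l}) := by
    ext τ; simp [openSimplex]
  rw [this]
  exact MeasurableSet.iInter fun k =>
    (measurableSet_lt measurable_const (by fun_prop)).inter
      (measurableSet_lt (by fun_prop) (by fun_prop))

lemma Fin.sum_Iic_eq_sum_ite {n : ℕ} (f : Fin n → ℝ) (k : Fin n) :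
    ∑ l ∈ Finset.Iic k, f l = ∑ l, if l ≤ k then f l else 0 := by
  rw [← Finset.sum_filter]; congr 1; ext; simp

lemma Fin.sum_Iio_eq_sum_ite {n : ℕ} (f : Fin n → ℝ) (k : Fin n) :
    ∑ l ∈ Finset.Iio k, f l = ∑ l, if l < k then f l else 0 := by
  rw [← Finset.sum_filter]; congr 1; ext; simp

lemma Fin.sum_Iic_cons_succ {n : ℕ} (s : ℝ) (τ : Fin n → ℝ) (k : Fin n) :
    ∑ l ∈ Finset.Iic k.succ, (Fin.cons s τ : Fin (n + 1) → ℝ) l = s + ∑ l ∈ Finset.Iic k, τ l := by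
  simp [Fin.sum_Iic_eq_sum_ite, Fin.sum_univ_succ]

lemma Fin.sum_Iio_cons_succ {n : ℕ} (s : ℝ) (τ : Fin n → ℝ) (k : Fin n) :
    ∑ l ∈ Finset.Iio k.succ, (Fin.cons s τ : Fin (n + 1) → ℝ) l = s + ∑ l ∈ Finset.Iio k, τ l := by
  simp [Fin.sum_Iio_eq_sum_ite, Fin.sum_univ_succ]

lemma Fin.cons_mem_openSimplex {n : ℕ} {t s : ℝ} {τ : Fin n → ℝ} :
    (Fin.cons s τ : Fin (n + 1) → ℝ) ∈ openSimplex (n + 1) t ↔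
      s ∈ Set.Ioo 0 t ∧ τ ∈ openSimplex n (t - s) := by
  simp only [openSimplex, Set.mem_ofPred_eq, Fin.forall_fin_succ, Fin.cons_zero, Fin.cons_succ,
    Fin.sum_Iio_cons_succ, sub_sub, Set.mem_Ioo]
  have : (Finset.Iio (0 : Fin (n + 1))) = ∅ := by ext; simp
  simp [this]

lemma sub_sum_Iic_pos {n : ℕ} {t : ℝ} {τ : Fin n → ℝ} (h : τ ∈ openSimplex n t) (k : Fin n) :
    0 < t - ∑ l ∈ Finset.Iic k, τ l := by
  have h1 := (h k).2
  rw [← Finset.Iio_insert, Finset.sum_insert (by simp)]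
  linarith

/-- The unnormalized generalized Dirichlet density. -/
def dirichletWeight {n : ℕ} (a b : Fin n → ℝ) (t : ℝ) (τ : Fin n → ℝ) : ℝ :=
  ∏ k, (τ k ^ (a k - 1) * (t - ∑ l ∈ Finset.Iic k, τ l) ^ (b k - 1))

lemma dirichletWeight_nonneg {n : ℕ} (a b : Fin n → ℝ) {t : ℝ} {τ : Fin n → ℝ}
    (h : τ ∈ openSimplex n t) : 0 ≤ dirichletWeight a b t τ :=
  Finset.prod_nonneg fun k _ => mul_nonneg (Real.rpow_nonneg (h k).1.le _)
    (Real.rpow_nonneg (sub_sum_Iic_pos h k).le _)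

/-- The product of `g` over the steps `τ_1, …, τ_n, t - (τ_1 + … + τ_n)`. -/
def stepProd (g : ℝ → ℝ) {n : ℕ} (t : ℝ) (τ : Fin n → ℝ) : ℝ := (∏ k, g (τ k)) * g (t - ∑ k, τ k)

/-- The integrand of the average of `stepProd g` against the unnormalized generalized Dirichlet
density. -/
def dirichletIntegrand {n : ℕ} (a b : Fin n → ℝ) (g : ℝ → ℝ) (t : ℝ) : (Fin n → ℝ) → ℝ :=
  (openSimplex n t).indicator fun τ => dirichletWeight a b t τ * stepProd g t τ

lemma measurable_dirichletWeight {n : ℕ} (a b : Fin n → ℝ) (t : ℝ) :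
    Measurable (dirichletWeight a b t) := by
  unfold dirichletWeight; fun_prop

lemma measurable_stepProd {g : ℝ → ℝ} (hg : Measurable g) (n : ℕ) (t : ℝ) :
    Measurable (stepProd g t : (Fin n → ℝ) → ℝ) := by
  unfold stepProd; fun_prop

lemma measurable_dirichletIntegrand {n : ℕ} (a b : Fin n → ℝ) {g : ℝ → ℝ} (hg : Measurable g)
    (t : ℝ) : Measurable (dirichletIntegrand a b g t) :=
  ((measurable_dirichletWeight a b t).mul (measurable_stepProd hg n t)).indicator
    (measurableSet_openSimplex n t)

/-- Every later factor t - (s + τ_1 + … ) is a factor for side t - s, so the weight is of the same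
type once the first step is fixed. -/
lemma dirichletIntegrand_cons {n : ℕ} (a b : Fin (n + 1) → ℝ) (g : ℝ → ℝ) (t s : ℝ)
    (τ : Fin n → ℝ) :
    dirichletIntegrand a b g t (Fin.cons s τ) =
      (Set.Ioo 0 t).indicator (fun s => s ^ (a 0 - 1) * (t - s) ^ (b 0 - 1) * g s *
        dirichletIntegrand (fun k => a k.succ) (fun k => b k.succ) g (t - s) τ) s := by
  by_cases hs : s ∈ Set.Ioo 0 t
  · rw [Set.indicator_of_mem hs]
    by_cases hτ : τ ∈ openSimplex n (t - s)
    · rw [dirichletIntegrand, dirichletIntegrand, Set.indicator_of_mem hτ,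
        Set.indicator_of_mem (Fin.cons_mem_openSimplex.2 ⟨hs, hτ⟩)]
      have h0 : (Finset.Iic (0 : Fin (n + 1))) = {0} := by ext; simp
      simp only [dirichletWeight, stepProd, Fin.prod_univ_succ, Fin.cons_zero, Fin.cons_succ,
        Fin.sum_Iic_cons_succ, Fin.sum_univ_succ, h0, Finset.sum_singleton, sub_sub]
      ring
    · rw [dirichletIntegrand, dirichletIntegrand, Set.indicator_of_notMem hτ,
        Set.indicator_of_notMem fun h => hτ (Fin.cons_mem_openSimplex.1 h).2, mul_zero]
  · rw [dirichletIntegrand, Set.indicator_of_notMem hs,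
      Set.indicator_of_notMem fun h => hs (Fin.cons_mem_openSimplex.1 h).1]

lemma abs_stepProd_le_one {g : ℝ → ℝ} (hg : ∀ x, |g x| ≤ 1) {n : ℕ} (t : ℝ) (τ : Fin n → ℝ) :
    |stepProd g t τ| ≤ 1 := by
  rw [stepProd, abs_mul, Finset.abs_prod]
  exact mul_le_one₀ (Finset.prod_le_one (fun _ _ => abs_nonneg _) fun _ _ => hg _)
    (abs_nonneg _) (hg _)

lemma norm_dirichletIntegrand_le {n : ℕ} (a b : Fin n → ℝ) {g : ℝ → ℝ} (hg : ∀ x, |g x| ≤ 1)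
    (t : ℝ) (τ : Fin n → ℝ) :
    ‖dirichletIntegrand a b g t τ‖ ≤ dirichletIntegrand a b (fun _ => 1) t τ := by
  unfold dirichletIntegrand
  by_cases h : τ ∈ openSimplex n t
  · rw [Set.indicator_of_mem h, Set.indicator_of_mem h, norm_mul,
      Real.norm_of_nonneg (dirichletWeight_nonneg a b h)]
    exact mul_le_mul_of_nonneg_left ((abs_stepProd_le_one hg t τ).trans (by simp [stepProd]))
      (dirichletWeight_nonneg a b h)
  · simp [h]

/-- Integration against a generalized Dirichlet density of a product of normalized Bessel functions
of index `μ` gives a multiple of a power times the normalized Bessel function of index `ν`. -/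
def BesselDirichlet (μ : ℝ) {n : ℕ} (a b : Fin n → ℝ) (e ν : ℝ) : Prop :=
  -- K is independent of r, so that r = 0 determines it.
  ∃ K : ℝ, ∀ r t : ℝ, 0 < t →
    Integrable (dirichletIntegrand a b (fun x => besselN μ (r * x)) t) ∧
    ∫ τ, dirichletIntegrand a b (fun x => besselN μ (r * x)) t τ = K * t ^ e * besselN ν (r * t)

lemma besselDirichlet_zero (μ : ℝ) (a b : Fin 0 → ℝ) : BesselDirichlet μ a b 0 μ := by
  refine ⟨1, fun r t ht => ?_⟩
  have h : dirichletIntegrand a b (fun x => besselN μ (r * x)) t =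
      fun _ => besselN μ (r * t) := by
    ext τ
    rw [dirichletIntegrand, Set.indicator_of_mem (fun k => k.elim0)]
    simp [dirichletWeight, stepProd]
  rw [h]
  have : IsProbabilityMeasure (volume : Measure (Fin 0 → ℝ)) :=
    ⟨by simp [volume_pi]⟩
  exact ⟨integrable_const _, by simp⟩

/-- Fubini in the first step s: the inner integral contributes (t-s)^e, which merges with
(t-s)^(b₀-1) into the exponent B - 1, and the outer integral is a Bessel convolution. -/
theorem BesselDirichlet.succ {μ : ℝ} (hμ : 0 < μ) (hb1 : ∀ x, |besselN μ x| ≤ 1) {n : ℕ}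
    {a b : Fin (n + 1) → ℝ} {e ν κ A B : ℝ} (hν : 0 < ν) (hA : 0 < A) (hB : 0 < B)
    (h : BesselDirichlet μ (fun k => a k.succ) (fun k => b k.succ) e ν)
    (ha : a 0 = A) (hb : b 0 + e = B) (hc : BesselCompatible μ A ν B κ) :
    BesselDirichlet μ a b (A + B - 1) κ := by
  obtain ⟨K, hK⟩ := h
  refine ⟨K * beta A B, fun r t ht => ?_⟩
  set g : ℝ → ℝ := fun x => besselN μ (r * x) with hg
  have hgm : Measurable g := ((continuous_besselN hμ).comp (by fun_prop)).measurable
  set a' : Fin n → ℝ := fun k => a k.succ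
  set b' : Fin n → ℝ := fun k => b k.succ
  -- At r = 0 all Bessel factors equal 1, so the hypothesis also controls the bare weight. By `hb1`
  -- it dominates the integrand.
  have hone : ∀ u, 0 < u → Integrable (dirichletIntegrand a' b' (fun _ => 1) u) ∧
      ∫ τ, dirichletIntegrand a' b' (fun _ => 1) u τ = K * u ^ e := by
    intro u hu
    simpa using hK 0 u hu
  have hpow : ∀ s ∈ Set.Ioo 0 t, (t - s) ^ (b 0 - 1) * (t - s) ^ e = (t - s) ^ (B - 1) := by
    intro s hs
    rw [← Real.rpow_add (by linarith [hs.2]), ← hb]; congr 1; ring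
  set f : ℝ × (Fin n → ℝ) → ℝ := fun p => dirichletIntegrand a b g t (Fin.cons p.1 p.2) with hf
  have hmp := volume_preserving_piFinSuccAbove (fun _ : Fin (n + 1) => ℝ) 0
  have hfe : f = dirichletIntegrand a b g t ∘
      (MeasurableEquiv.piFinSuccAbove (fun _ : Fin (n + 1) => ℝ) 0).symm := by
    ext p
    simp [hf, MeasurableEquiv.piFinSuccAbove, Fin.consEquiv]
  have hfm : Measurable f := by
    rw [hfe]
    exact (measurable_dirichletIntegrand a b hgm t).comp (MeasurableEquiv.measurable _)
  have hfs : ∀ s τ, f (s, τ) = (Set.Ioo 0 t).indicator (fun s => s ^ (A - 1) *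
      (t - s) ^ (b 0 - 1) * g s * dirichletIntegrand a' b' g (t - s) τ) s := by
    intro s τ
    rw [← ha]
    exact dirichletIntegrand_cons a b g t s τ
  have hint : Integrable f (volume.prod volume) := by
    rw [integrable_prod_iff hfm.aestronglyMeasurable]
    refine ⟨.of_forall fun s => ?_, ?_⟩
    · simp_rw [hfs]
      by_cases hs : s ∈ Set.Ioo 0 t
      · simp_rw [Set.indicator_of_mem hs]
        exact (hK r (t - s) (by linarith [hs.2])).1.const_mul _
      · simp [Set.indicator_of_notMem hs]
    · have hbd : Integrable ((Set.Ioo 0 t).indicator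
          fun s => s ^ (A - 1) * (t - s) ^ (B - 1) * K) :=
        (integrable_indicator_iff measurableSet_Ioo).2
          ((integrableOn_rpow_mul_sub_rpow hA hB ht).mul_const K)
      refine hbd.mono' hfm.norm.aestronglyMeasurable.integral_prod_right' (.of_forall fun s => ?_)
      rw [Real.norm_of_nonneg (integral_nonneg fun _ => norm_nonneg _)]
      by_cases hs : s ∈ Set.Ioo 0 t
      · have hts : 0 < t - s := by linarith [hs.2]
        rw [Set.indicator_of_mem hs, ← hpow s hs]
        calc ∫ τ, ‖f (s, τ)‖ ≤ ∫ τ, s ^ (A - 1) * (t - s) ^ (b 0 - 1) *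
              dirichletIntegrand a' b' (fun _ => 1) (t - s) τ := by
              refine integral_mono_of_nonneg (.of_forall fun _ => norm_nonneg _)
                ((hone _ hts).1.const_mul _) (.of_forall fun τ => ?_)
              have hw : 0 ≤ s ^ (A - 1) * (t - s) ^ (b 0 - 1) :=
                mul_nonneg (Real.rpow_nonneg hs.1.le _) (Real.rpow_nonneg hts.le _)
              simp only [hfs, Set.indicator_of_mem hs, norm_mul _ (dirichletIntegrand _ _ _ _ _),
                norm_mul _ (g s), Real.norm_of_nonneg hw]
              refine mul_le_mul ?_ (norm_dirichletIntegrand_le a' b' (fun x => hb1 _) _ _)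
                (norm_nonneg _) hw
              exact mul_le_of_le_one_right hw (hb1 _)
          _ = s ^ (A - 1) * ((t - s) ^ (b 0 - 1) * (t - s) ^ e) * K := by
              rw [integral_const_mul, (hone _ hts).2]; ring
      · simp [hfs, Set.indicator_of_notMem hs]
  have hcomp : dirichletIntegrand a b g t =
      f ∘ (MeasurableEquiv.piFinSuccAbove (fun _ : Fin (n + 1) => ℝ) 0) := by
    rw [hfe, Function.comp_assoc]; simp
  constructor
  · rw [hcomp]
    exact (hmp.integrable_comp_emb (MeasurableEquiv.measurableEmbedding _)).2 hint
  · rw [hcomp]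
    simp only [Function.comp_apply]
    rw [hmp.integral_comp (MeasurableEquiv.measurableEmbedding _) f,
      show (volume : Measure (ℝ × (Fin n → ℝ))) = volume.prod volume from rfl, integral_prod _ hint]
    have hin : ∀ s, ∫ τ, f (s, τ) = (Set.Ioo 0 t).indicator (fun s => K *
        (s ^ (A - 1) * (t - s) ^ (B - 1) * (besselN μ (r * s) * besselN ν (r * (t - s))))) s := by
      intro s
      by_cases hs : s ∈ Set.Ioo 0 t
      · simp_rw [hfs, Set.indicator_of_mem hs]
        rw [integral_const_mul, (hK r (t - s) (by linarith [hs.2])).2, ← hpow s hs]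
        ring
      · simp [hfs, Set.indicator_of_notMem hs]
    simp_rw [hin]
    rw [integral_indicator measurableSet_Ioo, integral_const_mul,
      setIntegral_besselN_mul_besselN hμ hA hν hB hc ht]
    ring

/-- The maximum with 0 reflects the truncation in `ENNReal.ofReal`; it spares a proof that the
constant is nonnegative. -/
lemma integral_genDirichlet {n : ℕ} (a b : Fin n → ℝ) (t : ℝ) (F : (Fin n → ℝ) → ℝ) :
    ∫ τ, F τ ∂(genDirichlet a b t) = max (genDirichletConst a b t) 0 *
      ∫ τ, (openSimplex n t).indicator (fun τ => dirichletWeight a b t τ * F τ) τ := by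
  have hm : Measurable fun τ => ENNReal.ofReal (genDirichletDensity a b t τ) :=
    ((measurable_dirichletWeight a b t).const_mul _).ennreal_ofReal
  rw [genDirichlet, integral_withDensity_eq_integral_toReal_smul hm
    (.of_forall fun _ => ENNReal.ofReal_lt_top), integral_indicator (measurableSet_openSimplex n t),
    ← integral_const_mul]
  refine setIntegral_congr_fun (measurableSet_openSimplex n t) fun τ hτ => ?_
  have hw := dirichletWeight_nonneg a b hτ
  have hd : genDirichletDensity a b t τ = genDirichletConst a b t * dirichletWeight a b t τ := rfl
  simp only [hd, smul_eq_mul]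
  rw [ENNReal.toReal_ofReal', ← mul_assoc, max_mul_of_nonneg _ _ hw, zero_mul]

/-- At r = 0 the left side is the total mass 1, which identifies the product of all constants and of
t^e as 1. -/
theorem BesselDirichlet.integral_stepProd {μ : ℝ} {n : ℕ} {a b : Fin n → ℝ} {e ν : ℝ}
    (h : BesselDirichlet μ a b e ν) {t : ℝ} (ht : 0 < t)
    [IsProbabilityMeasure (genDirichlet a b t)] (r : ℝ) :
    ∫ τ, stepProd (fun x => besselN μ (r * x)) t τ ∂(genDirichlet a b t) = besselN ν (r * t) := by
  obtain ⟨K, hK⟩ := h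
  have key : ∀ r, ∫ τ, stepProd (fun x => besselN μ (r * x)) t τ ∂(genDirichlet a b t) =
      max (genDirichletConst a b t) 0 * (K * t ^ e * besselN ν (r * t)) := fun r => by
    rw [integral_genDirichlet, ← (hK r t ht).2]; rfl
  have h0 := key 0
  simp only [zero_mul, besselN_zero, stepProd, Finset.prod_const_one, mul_one, integral_const,
    probReal_univ, smul_eq_mul] at h0
  rw [key, ← mul_assoc, ← h0, one_mul]

lemma besselCompatible_sub_fin {μ ν : ℝ} (hμ : 0 < μ) (hν : 0 < ν) (i : Fin 2) :
    BesselCompatible μ μ ν (ν + 1 - (i : ℕ)) (μ + ν) := by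
  fin_cases i
  · simpa using besselCompatible_add_one hμ hν
  · simpa using besselCompatible_self hμ hν

lemma besselCompatible_add_fin {μ ν : ℝ} (hμ : 0 < μ) (hν : 0 < ν) (h : Fin 2) :
    BesselCompatible μ (2 * μ + 1) ν (2 * ν + 1 + (h : ℕ)) (μ + ν + 1 / 2) := by
  fin_cases h
  · simpa using besselCompatible_two_mul_add_one hμ hν
  · convert besselCompatible_two_mul_add_two hμ hν using 1
    norm_num
    ring

lemma Fin.val_two_le_one (i : Fin 2) : ((i : ℕ) : ℝ) ≤ 1 := by
  exact_mod_cast Nat.le_of_lt_succ i.2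

/-! ### The parameters of the walk with switching phase. -/

section Switch

variable (d : ℕ) (h i : Fin 2)

/-- Deleting the first step lowers n and j together, which drives the induction over the first
phase. -/
lemma switchA_succ (j n k : ℕ) : switchA d (j + 1) (n + 1) (k + 1) = switchA d j n k := by
  simp [switchA]

lemma switchB_succ (j n k : ℕ) :
    switchB d h i (j + 1) (n + 1) (k + 1) = switchB d h i j n k := by
  simp [switchB]

/-- The steps after the switch: with j = 0 the index k = j never occurs, so h is absent. The last b
brings -i into the exponent e, and b = 1 elsewhere keeps B = ν + 1 - i. -/
lemma besselDirichlet_switch_zero (hd : 3 ≤ d)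
    (hb : ∀ x, |besselN ((d : ℝ) / 2 - 1) x| ≤ 1) (n : ℕ) :
    BesselDirichlet ((d : ℝ) / 2 - 1) (fun k : Fin (n + 1) => switchA d 0 (n + 1) ((k : ℕ) + 1))
      (fun k : Fin (n + 1) => switchB d h i 0 (n + 1) ((k : ℕ) + 1))
      (((n : ℝ) + 2) * ((d : ℝ) / 2 - 1) - (i : ℕ)) (((n : ℝ) + 2) * ((d : ℝ) / 2 - 1)) := by
  have hd' : (3 : ℝ) ≤ d := by exact_mod_cast hd
  have hμ : 0 < (d : ℝ) / 2 - 1 := by linarith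
  have hi := Fin.val_two_le_one i
  induction n with
  | zero =>
    convert BesselDirichlet.succ (A := (d : ℝ) / 2 - 1) (B := (d : ℝ) / 2 - 1 + 1 - (i : ℕ)) hμ hb
      hμ hμ (by linarith) (besselDirichlet_zero _ _ _) ?_ ?_
      (besselCompatible_sub_fin hμ hμ i) using 1
    · push_cast; ring
    · push_cast; ring
    · simp [switchA]
    · simp [switchB]
  | succ n ih =>
    have hν : 0 < ((n : ℝ) + 2) * ((d : ℝ) / 2 - 1) := by positivity
    convert BesselDirichlet.succ (A := (d : ℝ) / 2 - 1)
      (B := ((n : ℝ) + 2) * ((d : ℝ) / 2 - 1) + 1 - (i : ℕ)) hμ hb hν hμ (by linarith)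
      (e := ((n : ℝ) + 2) * ((d : ℝ) / 2 - 1) - (i : ℕ)) ?_ ?_ ?_
      (besselCompatible_sub_fin hμ hν i) using 1
    · push_cast; ring
    · push_cast; ring
    · convert ih using 2
      · simp [switchA]
      · simp [switchB]
    · simp [switchA]
    · simp [switchB]; ring

lemma besselDirichlet_switch_succ (hd : 3 ≤ d)
    (hb : ∀ x, |besselN ((d : ℝ) / 2 - 1) x| ≤ 1) (m j : ℕ) :
    BesselDirichlet ((d : ℝ) / 2 - 1)
      (fun k : Fin (m + 1 + j + 1) => switchA d (j + 1) (m + 1 + j + 1) ((k : ℕ) + 1))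
      (fun k : Fin (m + 1 + j + 1) => switchB d h i (j + 1) (m + 1 + j + 1) ((k : ℕ) + 1))
      (2 * (((m : ℝ) + j + 3) * ((d : ℝ) / 2 - 1) + (j + 1) / 2) + (h : ℕ))
      (((m : ℝ) + j + 3) * ((d : ℝ) / 2 - 1) + (j + 1) / 2) := by
  have hd' : (3 : ℝ) ≤ d := by exact_mod_cast hd
  have hμ : 0 < (d : ℝ) / 2 - 1 := by linarith
  induction j with
  | zero =>
    have hν : 0 < ((m : ℝ) + 2) * ((d : ℝ) / 2 - 1) := by positivity
    -- This is the step k = j. Its b equals ν + i + h + 1 and the tail exponent is ν - i, so i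
    -- cancels in B = 2ν + 1 + h.
    convert BesselDirichlet.succ (A := 2 * ((d : ℝ) / 2 - 1) + 1)
      (B := 2 * (((m : ℝ) + 2) * ((d : ℝ) / 2 - 1)) + 1 + (h : ℕ)) hμ hb hν (by positivity)
      (by positivity) (e := ((m : ℝ) + 2) * ((d : ℝ) / 2 - 1) - (i : ℕ)) ?_ ?_ ?_
      (besselCompatible_add_fin hμ hν h) using 1
    · push_cast; ring
    · push_cast; ring
    · convert besselDirichlet_switch_zero d h i hd hb m using 2
      · simp [switchA]
      · simp [switchB]
    · simp [switchA]; ring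
    · simp [switchB]; ring
  | succ j ih =>
    have hν : 0 < ((m : ℝ) + j + 3) * ((d : ℝ) / 2 - 1) + (j + 1) / 2 := by positivity
    -- Earlier steps have b = 1 and tail exponent 2ν + h, so B is again 2ν + 1 + h.
    convert BesselDirichlet.succ (A := 2 * ((d : ℝ) / 2 - 1) + 1)
      (B := 2 * (((m : ℝ) + j + 3) * ((d : ℝ) / 2 - 1) + (j + 1) / 2) + 1 + (h : ℕ)) hμ hb hν
      (by positivity) (by positivity)
      (e := 2 * (((m : ℝ) + j + 3) * ((d : ℝ) / 2 - 1) + (j + 1) / 2) + (h : ℕ)) ?_ ?_ ?_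
      (besselCompatible_add_fin hμ hν h) using 1
    · push_cast; ring
    · push_cast; ring
    · have hA := fun k => switchA_succ d (j + 1) (m + 1 + j + 1) (k + 1)
      have hB := fun k => switchB_succ d h i (j + 1) (m + 1 + j + 1) (k + 1)
      simp_rw [← hA, ← hB] at ih
      exact ih
    · simp [switchA]; ring
    · simp [switchB]; ring

theorem integral_stepProd_switchLaw (hd : 3 ≤ d) (hb : ∀ x, |besselN ((d : ℝ) / 2 - 1) x| ≤ 1)
    {j n : ℕ} (hj : 1 ≤ j) (hn : j < n) {t : ℝ} (ht : 0 < t)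
    [IsProbabilityMeasure (switchLaw d h i j n t)] (r : ℝ) :
    ∫ τ, stepProd (fun x => besselN ((d : ℝ) / 2 - 1) (r * x)) t τ ∂(switchLaw d h i j n t) =
      besselN (((n : ℝ) + 1) * ((d : ℝ) / 2 - 1) + (j : ℝ) / 2) (r * t) := by
  obtain ⟨j, rfl⟩ := Nat.exists_eq_add_of_le' hj
  obtain ⟨m, rfl⟩ : ∃ m, n = m + 1 + j + 1 := ⟨n - j - 2, by omega⟩
  have : IsProbabilityMeasure (genDirichlet
    (fun k : Fin (m + 1 + j + 1) => switchA d (j + 1) (m + 1 + j + 1) ((k : ℕ) + 1))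
    (fun k : Fin (m + 1 + j + 1) => switchB d h i (j + 1) (m + 1 + j + 1) ((k : ℕ) + 1)) t) :=
    inferInstanceAs (IsProbabilityMeasure (switchLaw d h i (j + 1) (m + 1 + j + 1) t))
  rw [switchLaw, (besselDirichlet_switch_succ d h i hd hb m j).integral_stepProd ht r]
  congr 1
  push_cast; ring

end Switch

lemma risingFac_one (n : ℕ) : risingFac 1 n = n.factorial := by
  induction n with
  | zero => simp
  | succ n ih => rw [risingFac_succ, ih, Nat.factorial_succ]; push_cast; ring

/-! ### Polar coordinates and Gaussian moments. -/

section Polar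

variable {E : Type*} [NormedAddCommGroup E] [NormedSpace ℝ E] [MeasurableSpace E] [BorelSpace E]
  [FiniteDimensional ℝ E] [Nontrivial E] (μ : Measure E) [μ.IsAddHaarMeasure]

/-- Polar coordinates for the product of a homogeneous and a radial function. -/
lemma integral_homogeneous_mul_radial {f : E → ℝ} {k : ℕ}
    (hf : ∀ (r : ℝ) x, 0 < r → f (r • x) = r ^ k * f x) (g : ℝ → ℝ) :
    ∫ x, f x * g ‖x‖ ∂μ = (∫ v, f v ∂μ.toSphere) *
      ∫ r in Set.Ioi (0 : ℝ), r ^ (Module.finrank ℝ E - 1) * (r ^ k * g r) := by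
  calc ∫ x, f x * g ‖x‖ ∂μ
      = ∫ x : ({(0)}ᶜ : Set E), f x.1 * g ‖x.1‖ ∂(μ.comap (↑)) := by
        rw [integral_subtype_comap (measurableSet_singleton _).compl fun x ↦ f x * g ‖x‖,
          restrict_compl_singleton]
    _ = ∫ p, f p.1 * ((p.2 : ℝ) ^ k * g p.2)
          ∂μ.toSphere.prod (.volumeIoiPow (Module.finrank ℝ E - 1)) := by
        rw [← μ.measurePreserving_homeomorphUnitSphereProd.integral_comp
          (Homeomorph.measurableEmbedding _)]
        refine integral_congr_ae (.of_forall fun x => ?_)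
        have hx : 0 < ‖x.1‖ := norm_pos_iff.2 x.2
        have h1 : f x.1 = ‖x.1‖ ^ k * f (‖x.1‖⁻¹ • x.1) := by
          rw [← hf _ _ hx, smul_inv_smul₀ hx.ne']
        simp only [homeomorphUnitSphereProd_apply_snd_coe, homeomorphUnitSphereProd_apply_fst_coe]
        rw [h1]
        ring
    _ = (∫ v, f v ∂μ.toSphere) *
          ∫ r : Set.Ioi (0 : ℝ), (r : ℝ) ^ k * g r ∂.volumeIoiPow (Module.finrank ℝ E - 1) :=
        integral_prod_mul (fun v : Metric.sphere (0 : E) 1 => f v)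
          (fun r : Set.Ioi (0 : ℝ) => (r : ℝ) ^ k * g r)
    _ = _ := by
        congr 1
        simp only [Measure.volumeIoiPow, ENNReal.ofReal]
        rw [integral_withDensity_eq_integral_smul,
          integral_subtype_comap measurableSet_Ioi fun a ↦
            Real.toNNReal (a ^ (Module.finrank ℝ E - 1)) • (a ^ k * g a),
          setIntegral_congr_fun measurableSet_Ioi fun x hx ↦ ?_]
        · rw [NNReal.smul_def, Real.coe_toNNReal _ (pow_nonneg (Set.mem_Ioi.1 hx).le _),
            smul_eq_mul]
        · exact (measurable_subtype_coe.pow_const _).real_toNNReal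

end Polar

lemma integral_Ioi_pow_mul_exp_neg_sq (k : ℕ) :
    ∫ x in Set.Ioi (0 : ℝ), x ^ k * Real.exp (-x ^ 2) = 1 / 2 * Real.Gamma ((k + 1) / 2) := by
  have h := integral_rpow_mul_exp_neg_rpow (p := 2) (q := k) two_pos
    (by have : (0 : ℝ) ≤ k := k.cast_nonneg
        linarith)
  rw [← h]
  refine setIntegral_congr_fun measurableSet_Ioi fun x _ => ?_
  simp only [Real.rpow_natCast, Real.rpow_ofNat]

lemma integral_pow_mul_exp_neg_sq_even (m : ℕ) :
    ∫ x : ℝ, x ^ (2 * m) * Real.exp (-x ^ 2) = risingFac (1 / 2) m * Real.Gamma (1 / 2) := by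
  have h := integral_comp_abs (f := fun x : ℝ => x ^ (2 * m) * Real.exp (-x ^ 2))
  simp only [sq_abs, pow_mul] at h
  simp only [pow_mul]
  rw [h]
  simp only [← pow_mul]
  rw [integral_Ioi_pow_mul_exp_neg_sq, ← Gamma_add_natCast (by norm_num)]
  push_cast
  rw [show (2 * (m : ℝ) + 1) / 2 = 1 / 2 + m by ring]
  ring

lemma integral_pow_mul_exp_neg_sq_odd (m : ℕ) :
    ∫ x : ℝ, x ^ (2 * m + 1) * Real.exp (-x ^ 2) = 0 := by
  have h := integral_neg_eq_self (fun x : ℝ => x ^ (2 * m + 1) * Real.exp (-x ^ 2)) volume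
  have h2 : ∀ x : ℝ, (-x) ^ (2 * m + 1) * Real.exp (-(-x) ^ 2) =
      -(x ^ (2 * m + 1) * Real.exp (-x ^ 2)) := fun x => by
    rw [neg_sq, Odd.neg_pow ⟨m, rfl⟩]; ring
  simp_rw [h2, integral_neg] at h
  linarith

lemma integral_inner_pow_mul_exp_neg_sq {d : ℕ} (i₀ : Fin d) (ξ : EuclideanSpace ℝ (Fin d))
    (k : ℕ) :
    ∫ x, (inner ℝ x ξ) ^ k * Real.exp (-‖x‖ ^ 2) =
      ‖ξ‖ ^ k * (∫ x : ℝ, x ^ k * Real.exp (-x ^ 2)) * (∫ x : ℝ, Real.exp (-x ^ 2)) ^ (d - 1) := by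
  set e : EuclideanSpace ℝ (Fin d) := EuclideanSpace.single i₀ 1 with he
  -- This reflection exchanges ξ with ‖ξ‖e, a vector of the same norm. It reduces the inner product
  -- to one coordinate, and the Gaussian then factorizes.
  set ρ := (ℝ ∙ (ξ - ‖ξ‖ • e))ᗮ.reflection
  have hρ : ρ ξ = ‖ξ‖ • e := Submodule.reflection_sub (by simp [he, norm_smul])
  have h1 : ∀ x, inner ℝ x ξ = ‖ξ‖ * (ρ x) i₀ := by
    intro x
    rw [← ρ.inner_map_map, hρ, inner_smul_right, he, EuclideanSpace.inner_single_right]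
    simp
  have h2 : ∫ x, (inner ℝ x ξ) ^ k * Real.exp (-‖x‖ ^ 2) =
      ∫ x : EuclideanSpace ℝ (Fin d), (‖ξ‖ * x i₀) ^ k * Real.exp (-‖x‖ ^ 2) := by
    have := ρ.measurePreserving.integral_comp ρ.toHomeomorph.measurableEmbedding
      (fun x : EuclideanSpace ℝ (Fin d) => (‖ξ‖ * x i₀) ^ k * Real.exp (-‖x‖ ^ 2))
    rw [← this]
    simp only [h1, ρ.norm_map]
  have h3 : ∀ x : Fin d → ℝ, (‖ξ‖ * x i₀) ^ k * Real.exp (-‖WithLp.toLp 2 x‖ ^ 2) =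
      ‖ξ‖ ^ k * ∏ i, ((if i = i₀ then x i ^ k else 1) * Real.exp (-x i ^ 2)) := by
    intro x
    rw [Finset.prod_mul_distrib, Finset.prod_ite_eq' Finset.univ i₀, EuclideanSpace.norm_sq_eq,
      ← Real.exp_sum]
    simp [Finset.sum_neg_distrib, mul_pow, mul_assoc]
  rw [h2, ← (PiLp.volume_preserving_toLp (Fin d)).integral_comp
    (MeasurableEquiv.toLp 2 (Fin d → ℝ)).measurableEmbedding]
  simp only [h3]
  rw [integral_const_mul, integral_fintype_prod_volume_eq_prod
    (fun i x => (if i = i₀ then x ^ k else 1) * Real.exp (-x ^ 2)),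
    ← Finset.mul_prod_erase _ _ (Finset.mem_univ i₀), mul_assoc]
  simp only [if_true]
  rw [Finset.prod_congr rfl (g := fun _ => ∫ x : ℝ, Real.exp (-x ^ 2)) (fun i hi => by
    simp [(Finset.mem_erase.1 hi).1]), Finset.prod_const, Finset.card_erase_of_mem
    (Finset.mem_univ _), Finset.card_univ, Fintype.card_fin]

/-! ### Moments and characteristic function of the uniform law on the sphere. -/

section Sphere

variable {d : ℕ}

lemma isProbabilityMeasure_uniformSphere (hd : 0 < d) :
    IsProbabilityMeasure (uniformSphere d) := by
  have : Nonempty (Fin d) := ⟨⟨0, hd⟩⟩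
  refine ⟨?_⟩
  rw [uniformSphere, Measure.map_apply measurable_subtype_coe .univ]
  simp only [Set.preimage_univ, Measure.smul_apply, smul_eq_mul]
  exact ENNReal.inv_mul_cancel (Measure.measure_univ_ne_zero.2
    (Measure.toSphere_ne_zero (volume : Measure (EuclideanSpace ℝ (Fin d))))) (measure_ne_top _ _)

lemma integral_uniformSphere {F : Type*} [NormedAddCommGroup F] [NormedSpace ℝ F]
    (f : EuclideanSpace ℝ (Fin d) → F) :
    ∫ v, f v ∂uniformSphere d =
      ((volume : Measure (EuclideanSpace ℝ (Fin d))).toSphere.real Set.univ)⁻¹ •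
        ∫ v, f v ∂(volume : Measure (EuclideanSpace ℝ (Fin d))).toSphere := by
  rw [uniformSphere, (MeasurableEmbedding.subtype_coe
    Metric.isClosed_sphere.measurableSet).integral_map, integral_smul_measure, ENNReal.toReal_inv]
  rfl

lemma norm_eq_one_ae_uniformSphere : ∀ᵐ v ∂uniformSphere d, ‖v‖ = 1 := by
  rw [uniformSphere, ae_map_iff measurable_subtype_coe.aemeasurable
    (measurableSet_eq_fun measurable_norm measurable_const)]
  exact .of_forall fun v => by simp

/-- The Gaussian moment computed twice: in polar coordinates, where the radial part is a Gamma
value, and in Cartesian ones. -/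
lemma integral_inner_pow_toSphere (hd : 0 < d) (ξ : EuclideanSpace ℝ (Fin d)) (k : ℕ) :
    (∫ v, (inner ℝ (v : EuclideanSpace ℝ (Fin d)) ξ) ^ k
        ∂(volume : Measure (EuclideanSpace ℝ (Fin d))).toSphere) *
      (1 / 2 * Real.Gamma (((d : ℝ) + k) / 2)) =
      ‖ξ‖ ^ k * (∫ x : ℝ, x ^ k * Real.exp (-x ^ 2)) *
        (∫ x : ℝ, Real.exp (-x ^ 2)) ^ (d - 1) := by
  have : Nonempty (Fin d) := ⟨⟨0, hd⟩⟩
  rw [← integral_inner_pow_mul_exp_neg_sq ⟨0, hd⟩,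
    integral_homogeneous_mul_radial volume (f := fun x => (inner ℝ x ξ) ^ k) (k := k)
      (fun r x _ => by rw [real_inner_smul_left, mul_pow]) (fun r => Real.exp (-r ^ 2))]
  congr 1
  simp only [← mul_assoc, ← pow_add, finrank_euclideanSpace, Fintype.card_fin]
  rw [integral_Ioi_pow_mul_exp_neg_sq]
  congr 3
  push_cast [Nat.cast_sub hd]
  ring

lemma integral_inner_pow_even_uniformSphere (hd : 0 < d) (ξ : EuclideanSpace ℝ (Fin d)) (m : ℕ) :
    ∫ v, (inner ℝ v ξ) ^ (2 * m) ∂uniformSphere d =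
      ‖ξ‖ ^ (2 * m) * (risingFac (1 / 2) m / risingFac ((d : ℝ) / 2) m) := by
  have hd' : (0 : ℝ) < d := by exact_mod_cast hd
  -- Exponent 0 gives the surface area; comparison with exponent 2m eliminates it together with the
  -- Gaussian constants.
  have h0 := integral_inner_pow_toSphere hd ξ 0
  have hm := integral_inner_pow_toSphere hd ξ (2 * m)
  have e0 := integral_pow_mul_exp_neg_sq_even 0
  rw [integral_pow_mul_exp_neg_sq_even, show ((d : ℝ) + (2 * m : ℕ)) / 2 = d / 2 + m by
    push_cast; ring, Gamma_add_natCast (by positivity)] at hm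
  simp only [mul_zero, pow_zero, one_mul, risingFac_zero] at e0
  simp only [pow_zero, one_mul, integral_const, smul_eq_mul, mul_one, e0, Nat.cast_zero,
    add_zero] at h0
  rw [integral_uniformSphere, smul_eq_mul]
  rw [e0] at hm
  have g1 := (Real.Gamma_pos_of_pos (s := (d : ℝ) / 2) (by positivity)).ne'
  have g2 := (Real.Gamma_pos_of_pos (s := 1 / 2) (by norm_num)).ne'
  have g3 := (risingFac_pos (x := (d : ℝ) / 2) (by positivity) m).ne'
  have hS : (volume : Measure (EuclideanSpace ℝ (Fin d))).toSphere.real Set.univ ≠ 0 := by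
    intro hS
    rw [hS, zero_mul] at h0
    exact (mul_ne_zero g2 (pow_ne_zero _ g2)) h0.symm
  rw [inv_mul_eq_iff_eq_mul₀ hS]
  have hm' : (∫ v, (inner ℝ (v : EuclideanSpace ℝ (Fin d)) ξ) ^ (2 * m)
        ∂(volume : Measure (EuclideanSpace ℝ (Fin d))).toSphere) * risingFac ((d : ℝ) / 2) m *
        (1 / 2 * Real.Gamma ((d : ℝ) / 2)) =
      ‖ξ‖ ^ (2 * m) * risingFac (1 / 2) m *
        (volume : Measure (EuclideanSpace ℝ (Fin d))).toSphere.real Set.univ *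
        (1 / 2 * Real.Gamma ((d : ℝ) / 2)) := by
    linear_combination hm - ‖ξ‖ ^ (2 * m) * risingFac (1 / 2) m * h0
  have := mul_right_cancel₀ (by positivity) hm'
  field_simp
  linear_combination this

lemma integral_inner_pow_odd_uniformSphere (hd : 0 < d) (ξ : EuclideanSpace ℝ (Fin d)) (m : ℕ) :
    ∫ v, (inner ℝ v ξ) ^ (2 * m + 1) ∂uniformSphere d = 0 := by
  have hm := integral_inner_pow_toSphere hd ξ (2 * m + 1)
  rw [integral_pow_mul_exp_neg_sq_odd, mul_zero, zero_mul] at hm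
  have g := Real.Gamma_pos_of_pos (s := ((d : ℝ) + (2 * m + 1 : ℕ)) / 2) (by positivity)
  rw [integral_uniformSphere, (mul_eq_zero.1 hm).resolve_right (by positivity), smul_zero]

/-- The characteristic function of the uniform distribution on the unit sphere. -/
theorem charFun_uniformSphere (hd : 3 ≤ d) (ξ : EuclideanSpace ℝ (Fin d)) :
    charFun (uniformSphere d) ξ = (besselN ((d : ℝ) / 2 - 1) ‖ξ‖ : ℝ) := by
  have hd0 : 0 < d := by omega
  have hd' : (3 : ℝ) ≤ d := by exact_mod_cast hd
  have := isProbabilityMeasure_uniformSphere hd0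
  have hsum : HasSum (fun k : ℕ => ∫ v, (((inner ℝ v ξ : ℝ) : ℂ) * Complex.I) ^ k / k.factorial
      ∂uniformSphere d) (charFun (uniformSphere d) ξ) := by
    rw [charFun_apply]
    refine hasSum_integral_of_dominated_convergence (fun k _ => ‖ξ‖ ^ k / k.factorial)
      (fun k => ?_) (fun k => ?_) ?_ ?_ ?_
    · exact Measurable.aestronglyMeasurable (by fun_prop)
    · filter_upwards [norm_eq_one_ae_uniformSphere] with v hv
      have := abs_real_inner_le_norm v ξ
      rw [hv, one_mul] at this
      rw [norm_div, norm_pow, norm_mul, Complex.norm_I, mul_one, Complex.norm_real,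
        Complex.norm_natCast, Real.norm_eq_abs]
      gcongr
    · exact .of_forall fun _ => Real.summable_pow_div_factorial _
    · exact integrable_const _
    · exact .of_forall fun v => by
        rw [Complex.exp_eq_exp_ℂ]
        exact NormedSpace.expSeries_div_hasSum_exp _
  have hterm : ∀ k : ℕ, ∫ v, (((inner ℝ v ξ : ℝ) : ℂ) * Complex.I) ^ k / k.factorial
      ∂uniformSphere d = ((∫ v, (inner ℝ v ξ) ^ k ∂uniformSphere d : ℝ) : ℂ) * Complex.I ^ k /
        k.factorial := by
    intro k
    rw [integral_div, ← integral_complex_ofReal, ← integral_mul_const]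
    simp [mul_pow]
  simp_rw [hterm] at hsum
  have hinj : Function.Injective (fun m : ℕ => 2 * m) := fun a b hab => by simpa using hab
  rw [← hinj.hasSum_iff] at hsum
  · refine hsum.unique ?_
    have h := hasSum_besselN (ν := (d : ℝ) / 2 - 1) (by linarith) ‖ξ‖
    convert Complex.hasSum_ofReal.2 h using 2 with m
    -- This is (2m)! = 4^m (1/2)_m m!, which turns the moments over (2m)! into Bessel coefficients.
    have h1 := risingFac_two_mul (1 / 2) m
    rw [show 2 * (1 / 2 : ℝ) = 1 by norm_num, show (1 / 2 : ℝ) + 1 / 2 = 1 by norm_num,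
      risingFac_one, risingFac_one] at h1
    have h2 := (risingFac_pos (x := 1 / 2) (by norm_num) m).ne'
    have h3 := (risingFac_pos (x := (d : ℝ) / 2) (by positivity) m).ne'
    have h4 : (m.factorial : ℝ) ≠ 0 := by positivity
    have h5 : Complex.I ^ (2 * m) = (((-1) ^ m : ℝ) : ℂ) := by
      rw [pow_mul, Complex.I_sq]; push_cast; rfl
    simp only [Function.comp_apply]
    rw [integral_inner_pow_even_uniformSphere hd0, h5, ← Complex.ofReal_natCast,
      ← Complex.ofReal_mul, ← Complex.ofReal_div, h1, besselCoeff, neg_pow (‖ξ‖ ^ 2 / 4), div_pow,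
      ← pow_mul, sub_add_cancel]
    congr 1
    field_simp
  · intro k hk
    obtain ⟨m, rfl⟩ : Odd k := by
      by_contra h
      obtain ⟨m, rfl⟩ := Nat.not_odd_iff_even.1 h
      exact hk ⟨m, by simp; ring⟩
    rw [integral_inner_pow_odd_uniformSphere hd0]
    simp

lemma besselN_abs (ν x : ℝ) : besselN ν |x| = besselN ν x := by simp [besselN]

/-- A characteristic function has modulus at most 1, and |x| is the norm of some vector. -/
lemma abs_besselN_le_one (hd : 3 ≤ d) (x : ℝ) : |besselN ((d : ℝ) / 2 - 1) x| ≤ 1 := by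
  have := isProbabilityMeasure_uniformSphere (d := d) (by omega)
  have h := norm_charFun_le_one (μ := uniformSphere d) (EuclideanSpace.single ⟨0, by omega⟩ x)
  rw [charFun_uniformSphere hd, Complex.norm_real] at h
  rw [PiLp.norm_single, Real.norm_eq_abs x, besselN_abs] at h
  exact h

end Sphere

/-! ### The conditional characteristic function of the walk. -/

lemma ProbabilityTheory.IndepFun.integral_prodMk {Ω α β : Type*} [MeasurableSpace Ω]
    [MeasurableSpace α] [MeasurableSpace β] {P : Measure Ω} [IsProbabilityMeasure P]
    {X : Ω → α} {Y : Ω → β} (h : IndepFun X Y P) (hX : Measurable X) (hY : Measurable Y)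
    {G : α × β → ℂ} (hG : Measurable G) {C : ℝ} (hC : ∀ p, ‖G p‖ ≤ C) :
    ∫ ω, G (X ω, Y ω) ∂P = ∫ ω, (∫ ω', G (X ω', Y ω) ∂P) ∂P := by
  have := Measure.isProbabilityMeasure_map (μ := P) hX.aemeasurable
  have := Measure.isProbabilityMeasure_map (μ := P) hY.aemeasurable
  have hint : Integrable G ((P.map X).prod (P.map Y)) :=
    Integrable.of_bound hG.aestronglyMeasurable C (.of_forall hC)
  rw [← integral_map (f := G) (hX.prodMk hY).aemeasurable hG.aestronglyMeasurable,
    (indepFun_iff_map_prod_eq_prod_map_map hX.aemeasurable hY.aemeasurable).1 h,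
    integral_prod_symm _ hint, integral_map hY.aemeasurable
      hint.integral_prod_right.aestronglyMeasurable]
  refine integral_congr_ae (.of_forall fun ω => ?_)
  exact integral_map hX.aemeasurable
    (hG.comp (measurable_id.prodMk measurable_const)).aestronglyMeasurable

lemma measurable_stepDuration (t : ℝ) (n k : ℕ) :
    Measurable fun τ : ℕ → ℝ => stepDuration t n τ k := by
  unfold stepDuration
  split_ifs <;> fun_prop

lemma measurable_comp_nat {Ω β : Type*} [MeasurableSpace Ω] [MeasurableSpace β] {N : Ω → ℕ}
    (hN : Measurable N) (X : ℕ → Ω → β) (h : ∀ n, Measurable (X n)) :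
    Measurable fun ω => X (N ω) ω := by
  have h2 : Measurable fun p : ℕ × Ω => X p.1 p.2 := measurable_from_prod_countable_right h
  exact h2.comp (hN.prodMk measurable_id)

lemma measurable_walkPosition {Ω : Type*} [MeasurableSpace Ω] {d : ℕ} (c t : ℝ) {N : Ω → ℕ}
    {τ : ℕ → Ω → ℝ} {V : ℕ → Ω → EuclideanSpace ℝ (Fin d)} (hN : Measurable N)
    (hτ : ∀ k, Measurable (τ k)) (hV : ∀ k, Measurable (V k)) :
    Measurable fun ω => walkPosition c t (N ω) (fun k => τ k ω) (fun k => V k ω) := by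
  have h : ∀ n, Measurable fun ω => walkPosition c t n (fun k => τ k ω) (fun k => V k ω) := by
    intro n
    refine (measurable_const_smul c).comp (Finset.measurable_fun_sum _ fun k _ => ?_)
    have h1 : Measurable fun ω => stepDuration t n (fun k => τ k ω) k :=
      (measurable_stepDuration t n k).comp (measurable_pi_lambda _ hτ)
    exact h1.smul (hV k)
  exact measurable_comp_nat hN _ h

lemma stepProd_eq_prod_stepDuration (g : ℝ → ℝ) (n : ℕ) (t : ℝ) (τ : ℕ → ℝ) :
    stepProd g t (fun k : Fin n => τ k) = ∏ k : Fin (n + 1), g (stepDuration t n τ k) := by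
  rw [Fin.prod_univ_castSucc]
  simp [stepProd, stepDuration, Finset.sum_range]

lemma cexp_inner_walkPosition {d : ℕ} (c t : ℝ) (n : ℕ) (τ : ℕ → ℝ)
    (V : ℕ → EuclideanSpace ℝ (Fin d)) (α : EuclideanSpace ℝ (Fin d)) :
    Complex.exp (((inner ℝ (walkPosition c t n τ V) α : ℝ) : ℂ) * Complex.I) =
      ∏ k : Fin (n + 1), Complex.exp (((inner ℝ (V k) ((c * stepDuration t n τ k) • α) : ℝ) : ℂ) *
        Complex.I) := by
  rw [← Complex.exp_sum, ← Finset.sum_mul, ← Complex.ofReal_sum, walkPosition,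
    real_inner_smul_left, sum_inner, Finset.mul_sum, Finset.sum_range]
  congr 3
  refine Finset.sum_congr rfl fun k _ => ?_
  rw [real_inner_smul_left, real_inner_smul_right]
  ring

section Walk

variable {Ω : Type*} [MeasurableSpace Ω] {P : Measure Ω}
  {d : ℕ} {h i : Fin 2} {j : ℕ} {t : ℝ} {N : Ω → ℕ} {τ : ℕ → Ω → ℝ}
  {V : ℕ → Ω → EuclideanSpace ℝ (Fin d)}

/-- For deterministic durations the factors are independent. Since `besselN` is even, the durations
may have any sign. -/
lemma IsSwitchingWalk.integral_prod_cexp (hX : IsSwitchingWalk P d h i j t N τ V) (hd : 3 ≤ d)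
    (n : ℕ) (s : ℕ → ℝ) (α : EuclideanSpace ℝ (Fin d)) :
    ∫ ω, ∏ k : Fin (n + 1), Complex.exp (((inner ℝ (V k ω) (s k • α) : ℝ) : ℂ) * Complex.I) ∂P =
      ((∏ k : Fin (n + 1), besselN ((d : ℝ) / 2 - 1) (s k * ‖α‖) : ℝ) : ℂ) := by
  have hV : iIndepFun (fun k : Fin (n + 1) => V k) P :=
    hX.iIndep_V.precomp Fin.val_injective
  rw [hV.integral_fun_prod_comp (f := fun (k : Fin (n + 1)) v =>
    Complex.exp (((inner ℝ v (s k • α) : ℝ) : ℂ) * Complex.I))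
    (fun k => (hX.measurable_V k).aemeasurable)
    (fun k => Measurable.aestronglyMeasurable (by fun_prop)), Complex.ofReal_prod]
  refine Finset.prod_congr rfl fun k _ => ?_
  rw [← integral_map (f := fun v => Complex.exp (((inner ℝ v (s k • α) : ℝ) : ℂ) * Complex.I))
    (hX.measurable_V k).aemeasurable (Measurable.aestronglyMeasurable (by fun_prop)), hX.law_V k,
    ← charFun_apply, charFun_uniformSphere hd, norm_smul, Real.norm_eq_abs,
    ← abs_of_nonneg (norm_nonneg α), ← abs_mul, besselN_abs, abs_of_nonneg (norm_nonneg α)]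

/-- Only the directions are averaged here, without the law of the durations, so the formula serves n
≤ j as well. -/
theorem IsSwitchingWalk.charFun_walkPosition [IsProbabilityMeasure P]
    (hX : IsSwitchingWalk P d h i j t N τ V)
    (hd : 3 ≤ d) (c : ℝ) (n : ℕ) (α : EuclideanSpace ℝ (Fin d)) :
    charFun ((cond P (N ⁻¹' {n})).map
        fun ω => walkPosition c t (N ω) (fun k => τ k ω) (fun k => V k ω)) α =
      ((∫ x, stepProd (fun s => besselN ((d : ℝ) / 2 - 1) (c * ‖α‖ * s)) t x
        ∂((cond P (N ⁻¹' {n})).map fun ω (k : Fin n) => τ k ω) : ℝ) : ℂ) := by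
  have hτ : Measurable fun ω (k : ℕ) => τ k ω := measurable_pi_lambda _ hX.measurable_tau
  have hV : Measurable fun ω (k : ℕ) => V k ω := measurable_pi_lambda _ hX.measurable_V
  have hS : MeasurableSet (N ⁻¹' {n}) := hX.measurable_N (measurableSet_singleton n)
  have hμ : 0 < (d : ℝ) / 2 - 1 := by
    have : (3 : ℝ) ≤ d := by exact_mod_cast hd
    linarith
  have hg : Measurable fun s => besselN ((d : ℝ) / 2 - 1) (c * ‖α‖ * s) :=
    ((continuous_besselN hμ).comp (by fun_prop)).measurable
  rw [charFun_apply, integral_map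
      (measurable_walkPosition c t hX.measurable_N hX.measurable_tau hX.measurable_V).aemeasurable
      (Measurable.aestronglyMeasurable (by fun_prop)),
    integral_map (measurable_pi_lambda _ fun k : Fin n => hX.measurable_tau k).aemeasurable
      (measurable_stepProd hg n t).aestronglyMeasurable, ← integral_complex_ofReal, ProbabilityTheory.cond,
    integral_smul_measure, integral_smul_measure]
  congr 1
  rw [← integral_indicator hS, ← integral_indicator hS]
  -- The event N = n depends on (N, τ) only, so its indicator is frozen with the durations while V
  -- is averaged.
  set G : (ℕ → EuclideanSpace ℝ (Fin d)) × (ℕ × (ℕ → ℝ)) → ℂ := fun p =>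
    (if p.2.1 = n then 1 else 0) * ∏ k : Fin (n + 1),
      Complex.exp (((inner ℝ (p.1 k) ((c * stepDuration t n p.2.2 k) • α) : ℝ) : ℂ) *
        Complex.I) with hG
  have hGm : Measurable G := by
    refine Measurable.mul (Measurable.ite ?_ measurable_const measurable_const)
      (Finset.measurable_fun_prod _ fun k _ => ?_)
    · exact measurableSet_eq_fun (by fun_prop) measurable_const
    · have h1 : Measurable fun p : (ℕ → EuclideanSpace ℝ (Fin d)) × (ℕ × (ℕ → ℝ)) =>
          stepDuration t n p.2.2 k := (measurable_stepDuration t n k).comp (by fun_prop)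
      fun_prop
  have hGb : ∀ p, ‖G p‖ ≤ 1 := by
    intro p
    rw [hG, norm_mul, norm_prod]
    simp only [Complex.norm_exp_ofReal_mul_I, Finset.prod_const_one, mul_one]
    split_ifs <;> simp
  have key := hX.indep_V.integral_prodMk hV (hX.measurable_N.prodMk hτ) hGm hGb
  calc _ = ∫ ω, G (fun k => V k ω, (N ω, fun k => τ k ω)) ∂P := by
        refine integral_congr_ae (.of_forall fun ω => ?_)
        by_cases hω : N ω = n
        · simp [Set.indicator, hG, hω, cexp_inner_walkPosition]
        · simp [Set.indicator, hG, hω]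
    _ = _ := by
        rw [key]
        refine integral_congr_ae (.of_forall fun ω => ?_)
        by_cases hω : N ω = n
        · simp only [hG, hω, if_true, one_mul, Set.indicator, Set.mem_preimage,
            Set.mem_singleton_iff]
          rw [hX.integral_prod_cexp hd n (fun k => c * stepDuration t n (fun k => τ k ω) k) α,
            stepProd_eq_prod_stepDuration _ n t (fun k => τ k ω)]
          congr 1
          exact Finset.prod_congr rfl fun k _ => by congr 1; ring
        · simp [Set.indicator, hG, hω]

end Walk

/-! ### Comparison of two walks. -/

lemma switchLaw_eq_of_le (d : ℕ) (h i h' i' : Fin 2) {j n : ℕ} (hn : n ≤ j) (t : ℝ) :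
    switchLaw d h i j n t = switchLaw d h' i' j n t := by
  simp only [switchLaw, switchB, hn, if_true]

/-- This covers n = 0, where `law_tau` is silent but there are no coordinates. -/
lemma eq_of_isProbabilityMeasure_of_subsingleton {α : Type*} [MeasurableSpace α] [Subsingleton α]
    (μ ν : Measure α) [IsProbabilityMeasure μ] [IsProbabilityMeasure ν] : μ = ν := by
  ext s _
  rcases s.eq_empty_or_nonempty with rfl | hs
  · simp
  · rw [Subsingleton.eq_univ_of_nonempty hs]; simp

section Walk

variable {Ω : Type*} [MeasurableSpace Ω] {P : Measure Ω} [IsProbabilityMeasure P]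
  {d : ℕ} {h i : Fin 2} {j : ℕ} {t : ℝ} {N : Ω → ℕ} {τ : ℕ → Ω → ℝ}
  {V : ℕ → Ω → EuclideanSpace ℝ (Fin d)}

theorem IsSwitchingWalk.charFun_walkPosition_of_lt (hX : IsSwitchingWalk P d h i j t N τ V)
    (hd : 3 ≤ d) (hj : 1 ≤ j) (ht : 0 < t) (c : ℝ) {n : ℕ} (hn : j < n)
    (hP : P (N ⁻¹' {n}) ≠ 0) (α : EuclideanSpace ℝ (Fin d)) :
    charFun ((ProbabilityTheory.cond P (N ⁻¹' {n})).map
        fun ω => walkPosition c t (N ω) (fun k => τ k ω) (fun k => V k ω)) α =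
      (besselN (((n : ℝ) + 1) * ((d : ℝ) / 2 - 1) + (j : ℝ) / 2) (c * ‖α‖ * t) : ℝ) := by
  have := cond_isProbabilityMeasure hP
  have hlaw := hX.law_tau n (by omega) hP
  -- Total mass one comes from being the law of a random vector, not from the Gamma constants.
  have : IsProbabilityMeasure (switchLaw d h i j n t) := by
    rw [← hlaw]
    exact Measure.isProbabilityMeasure_map
      (measurable_pi_lambda _ fun k : Fin n => hX.measurable_tau k).aemeasurable
  rw [hX.charFun_walkPosition hd, hlaw,
    integral_stepProd_switchLaw d h i hd (abs_besselN_le_one hd) hj hn ht]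

variable {Ω' : Type*} [MeasurableSpace Ω'] {P' : Measure Ω'} [IsProbabilityMeasure P']
  {h' i' : Fin 2} {N' : Ω' → ℕ} {τ' : ℕ → Ω' → ℝ} {V' : ℕ → Ω' → EuclideanSpace ℝ (Fin d)}

theorem IsSwitchingWalk.identDistrib_cond (hX : IsSwitchingWalk P d h i j t N τ V)
    (hX' : IsSwitchingWalk P' d h' i' j t N' τ' V') (hd : 3 ≤ d) (hj : 1 ≤ j) (ht : 0 < t) (c : ℝ)
    (n : ℕ) (hP : P (N ⁻¹' {n}) ≠ 0) (hP' : P' (N' ⁻¹' {n}) ≠ 0) :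
    IdentDistrib (fun ω => walkPosition c t (N ω) (fun k => τ k ω) (fun k => V k ω))
      (fun ω => walkPosition c t (N' ω) (fun k => τ' k ω) (fun k => V' k ω))
      (ProbabilityTheory.cond P (N ⁻¹' {n})) (ProbabilityTheory.cond P' (N' ⁻¹' {n})) := by
  have hm := measurable_walkPosition c t hX.measurable_N hX.measurable_tau hX.measurable_V
  have hm' := measurable_walkPosition c t hX'.measurable_N hX'.measurable_tau hX'.measurable_V
  have := cond_isProbabilityMeasure hP
  have := cond_isProbabilityMeasure hP'
  have := Measure.isProbabilityMeasure_map (μ := ProbabilityTheory.cond P (N ⁻¹' {n}))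
    hm.aemeasurable
  have := Measure.isProbabilityMeasure_map (μ := ProbabilityTheory.cond P' (N' ⁻¹' {n}))
    hm'.aemeasurable
  refine ⟨hm.aemeasurable, hm'.aemeasurable, Measure.ext_of_charFun (funext fun α => ?_)⟩
  by_cases hn : j < n
  · rw [hX.charFun_walkPosition_of_lt hd hj ht c hn hP,
      hX'.charFun_walkPosition_of_lt hd hj ht c hn hP']
  · rw [hX.charFun_walkPosition hd, hX'.charFun_walkPosition hd]
    congr 2
    rcases Nat.eq_zero_or_pos n with rfl | hn0
    · have := Measure.isProbabilityMeasure_map (μ := ProbabilityTheory.cond P (N ⁻¹' {0}))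
        (measurable_pi_lambda _ fun k : Fin 0 => hX.measurable_tau k).aemeasurable
      have := Measure.isProbabilityMeasure_map (μ := ProbabilityTheory.cond P' (N' ⁻¹' {0}))
        (measurable_pi_lambda _ fun k : Fin 0 => hX'.measurable_tau k).aemeasurable
      exact eq_of_isProbabilityMeasure_of_subsingleton _ _
    · rw [hX.law_tau n hn0 hP, hX'.law_tau n hn0 hP']
      exact switchLaw_eq_of_le d h i h' i' (not_lt.1 hn) t

end Walk

lemma measure_eq_tsum_inter_fiber {Ω : Type*} [MeasurableSpace Ω] {P : Measure Ω} {N : Ω → ℕ}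
    (hN : Measurable N) {A : Set Ω} (hA : MeasurableSet A) :
    P A = ∑' n, P (N ⁻¹' {n} ∩ A) := by
  rw [← measure_iUnion]
  · congr 1; ext ω; simp
  · intro m n hmn
    refine Set.disjoint_left.2 fun ω h1 h2 => hmn ?_
    exact h1.1.symm.trans h2.1
  · exact fun n => (hN (measurableSet_singleton n)).inter hA

/-- Total probability over the values of N; a value that is null for one walk is null for the other.
-/
lemma ProbabilityTheory.IdentDistrib.of_cond_nat {Ω Ω' β : Type*} [MeasurableSpace Ω]
    [MeasurableSpace Ω'] [MeasurableSpace β] {P : Measure Ω} {P' : Measure Ω'} [IsFiniteMeasure P]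
    [IsFiniteMeasure P'] {N : Ω → ℕ} {N' : Ω' → ℕ} (hN : Measurable N) (hN' : Measurable N')
    (hNN' : IdentDistrib N N' P P') {X : Ω → β} {X' : Ω' → β} (hX : Measurable X)
    (hX' : Measurable X')
    (h : ∀ n, P (N ⁻¹' {n}) ≠ 0 → P' (N' ⁻¹' {n}) ≠ 0 →
      IdentDistrib X X' (ProbabilityTheory.cond P (N ⁻¹' {n}))
        (ProbabilityTheory.cond P' (N' ⁻¹' {n}))) :
    IdentDistrib X X' P P' := by
  refine ⟨hX.aemeasurable, hX'.aemeasurable, Measure.ext fun s hs => ?_⟩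
  rw [Measure.map_apply hX hs, Measure.map_apply hX' hs,
    measure_eq_tsum_inter_fiber hN (hX hs), measure_eq_tsum_inter_fiber hN' (hX' hs)]
  refine tsum_congr fun n => ?_
  have hn : P (N ⁻¹' {n}) = P' (N' ⁻¹' {n}) := hNN'.measure_mem_eq (measurableSet_singleton n)
  by_cases h0 : P (N ⁻¹' {n}) = 0
  · rw [measure_mono_null Set.inter_subset_left h0,
      measure_mono_null Set.inter_subset_left (hn ▸ h0)]
  · rw [← cond_mul_eq_inter (hN (measurableSet_singleton n)),
      ← cond_mul_eq_inter (hN' (measurableSet_singleton n)), ← hn]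
    congr 1
    exact (h n h0 (hn ▸ h0)).measure_mem_eq hs

end

theorem mainTheorem2
    (d : ℕ) (hd : 3 ≤ d) (j : ℕ) (hj : 1 ≤ j) (c t : ℝ) (hc : 0 < c) (ht : 0 < t)
    (h i h' i' : Fin 2)
    {Ω : Type*} [MeasurableSpace Ω] (P : Measure Ω) [IsProbabilityMeasure P]
    (N : Ω → ℕ) (τ : ℕ → Ω → ℝ) (V : ℕ → Ω → EuclideanSpace ℝ (Fin d))
    (hX : IsSwitchingWalk P d h i j t N τ V)
    {Ω' : Type*} [MeasurableSpace Ω'] (P' : Measure Ω') [IsProbabilityMeasure P']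
    (N' : Ω' → ℕ) (τ' : ℕ → Ω' → ℝ) (V' : ℕ → Ω' → EuclideanSpace ℝ (Fin d))
    (hX' : IsSwitchingWalk P' d h' i' j t N' τ' V') :
    -- given the same number of changes of direction, the positions are identically distributed
    (∀ n : ℕ, P (N ⁻¹' {n}) ≠ 0 → P' (N' ⁻¹' {n}) ≠ 0 →
      IdentDistrib (fun ω => walkPosition c t (N ω) (fun k => τ k ω) (fun k => V k ω))
        (fun ω => walkPosition c t (N' ω) (fun k => τ' k ω) (fun k => V' k ω))
        (cond P (N ⁻¹' {n})) (cond P' (N' ⁻¹' {n}))) ∧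
    -- hence also unconditionally, if the numbers of changes of direction have the same law
    (IdentDistrib N N' P P' →
      IdentDistrib (fun ω => walkPosition c t (N ω) (fun k => τ k ω) (fun k => V k ω))
        (fun ω => walkPosition c t (N' ω) (fun k => τ' k ω) (fun k => V' k ω)) P P') ∧
    -- the common conditional characteristic function after the switch of phase
    (∀ n : ℕ, j < n → P (N ⁻¹' {n}) ≠ 0 → ∀ α : EuclideanSpace ℝ (Fin d), α ≠ 0 →
      ∫ ω, Complex.exp (Complex.I *
          ((inner ℝ α (walkPosition c t (N ω) (fun k => τ k ω) (fun k => V k ω)) : ℝ) : ℂ))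
          ∂(cond P (N ⁻¹' {n})) =
        (((2 : ℝ) ^ (((n : ℝ) + 1) * ((d : ℝ) / 2 - 1) + (j : ℝ) / 2) *
          Real.Gamma (((n : ℝ) + 1) * ((d : ℝ) / 2 - 1) + (j : ℝ) / 2 + 1) *
          (besselJ (((n : ℝ) + 1) * ((d : ℝ) / 2 - 1) + (j : ℝ) / 2) (c * t * ‖α‖) /
            (c * t * ‖α‖) ^ (((n : ℝ) + 1) * ((d : ℝ) / 2 - 1) + (j : ℝ) / 2)) : ℝ) : ℂ)) := by
  have hm := measurable_walkPosition c t hX.measurable_N hX.measurable_tau hX.measurable_V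
  have hm' := measurable_walkPosition c t hX'.measurable_N hX'.measurable_tau hX'.measurable_V
  have hcond := hX.identDistrib_cond hX' hd hj ht c
  refine ⟨hcond, fun hN => hN.of_cond_nat hX.measurable_N hX'.measurable_N hm hm' hcond, ?_⟩
  intro n hn hP α hα
  have hd' : (3 : ℝ) ≤ d := by exact_mod_cast hd
  have hν : 0 < ((n : ℝ) + 1) * ((d : ℝ) / 2 - 1) + (j : ℝ) / 2 := by
    have : 0 < (d : ℝ) / 2 - 1 := by linarith
    positivity
  have hx : 0 < c * t * ‖α‖ := by
    have := norm_pos_iff.2 hα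
    positivity
  rw [two_rpow_mul_Gamma_mul_besselJ hν hx, mul_right_comm,
    ← hX.charFun_walkPosition_of_lt hd hj ht c hn hP α, charFun_apply,
    integral_map hm.aemeasurable (Measurable.aestronglyMeasurable (by fun_prop))]
  simp only [real_inner_comm, mul_comm]
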